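/- For elements $g,h$ of a group write $[g,h]=g^{-1}h^{-1}gh$, and let $C_2^m$ be the elementary abelian group of order $2^m$. Let $n\ge 2$ be an integer. Let $\mathcal{H}(n)=\langle X_0\cup Y_0\mid \mathcal{R}\rangle$, where $X_0=\{x_1,\dots,x_n\}$, $Y_0=\{y_1,\dots,y_n\}$, and $\mathcal{R}$ consists of the relations $$z^2=1,\quad [x,x']=[y,y']=1,\quad [x,y]^2=1,\quad [[y,x],y']=1,\quad [[x,y],z]^2=1,\quad [[[z,z'],z''],z''']=1$$ for all $x,x'\in X_0$, $y,y'\in Y_0$ and $z,z',z'',z'''\in X_0\cup Y_0$. Let $F$ be the free group on $A=\{a_1,\dots,a_{2n}\}$, with derived subgroup $F'$ and lower central series $F=F_1\ge F_2=F'\ge F_3\ge F_4\ge\cdots$. Put $A_0=\{a_1,\dots,a_n\}$ and $B_0=\{a_{n+1},\dots,a_{2n}\}$. Let $$K=\langle F_4,\ a_i^2,\ [a_i,a_j]^2,\ [[a_i,a_j],a_k]^2,\ [[a_i,a_j],a_i]\ :\ 1\le i,j,k\le 2n\rangle,$$ $$I=\langle K,\ [a,a'],\ [b,b'],\ [[a,a'],c],\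 [[b,b'],c],\ [[b,a],b']\ :\ a,a'\in A_0,\ b,b'\in B_0,\ c\in A\rangle .$$ Let $D_I$ be the set consisting of the following elements of $F$, for $1\le i,j,k,\ell\le n$: * $[a_i,a_j]$ and $[a_{n+i},a_{n+j}]$, for $j<i$; * $[[a_i,a_j],a_k]$ and $[[a_{n+i},a_{n+j}],a_{n+k}]$, for $j<i$, $j<k$, $k\ne i$; * $[[a_i,a_j],a_{n+\ell}]$, $[[a_{n+i},a_{n+j}],a_\ell]$ and $[[a_{n+i},a_\ell],a_{n+j}]$, for $j<i$. Then $K$ and $I$ are normal subgroups of $F$, and the following hold. 1. $K<I\le F'I=F'K$ (with $K\neq I$), and $(F/I)/(F/I)'\cong F/F'I\cong C_2^{2n}$. 2. $I$ is generated by $K\cup D_I$. 3. $I/K\cong C_2^{v}$ with $v=(13n^3-15n^2+2n)/6$, and $F'I/I\cong C_2^{u}$ with $u=(n^3+n^2)/2$; moreover $F/I$ is nilpotent of class exactly $3$ and $|F/I|=2^{(n^3+n^2+4n)/2}$. 4. There are epimorphisms $\phi:\mathcal{H}(n)\to F/I$ with $\phi(x_i)=a_iI$, $\phi(y_i)=a_{n+i}I$,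 and $\psi:F/I\to\mathcal{H}(n)$ with $\psi(a_iI)=x_i$, $\psi(a_{n+i}I)=y_i$, for $1\le i\le n$, and $\phi$, $\psi$ are inverse to each other. In particular $\mathcal{H}(n)\cong F/I$. Hence $|\mathcal{H}(n)|=2^{(n^3+n^2+4n)/2}$, and $\mathcal{H}(n)$ is nilpotent of class exactly $3$. -/

import Mathlib

namespace MixedDihedral

/-- The commutator in the convention `[a, b] = a⁻¹ b⁻¹ a b`. -/
def comm {G : Type*} [Group G] (a b : G) : G := a⁻¹ * b⁻¹ * a * b

/-- An alphabet of `2 * n` letters, split into a first block `inl i` and a second block `inr i`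
(`i : Fin n`). -/
abbrev Letter (n : ℕ) : Type := Fin n ⊕ Fin n

/-- The free group `F` on `2 * n` generators. -/
abbrev F (n : ℕ) : Type := FreeGroup (Letter n)

/-- The free generator of `F n` attached to a letter. -/
abbrev gen {n : ℕ} (z : Letter n) : F n := FreeGroup.of z

/-- The generator `a_i` of the first block, `1 ≤ i ≤ n`. -/
abbrev a {n : ℕ} (i : Fin n) : F n := gen (Sum.inl i)

/-- The generator `a_{n+i}` of the second block, `1 ≤ i ≤ n`. -/
abbrev b {n : ℕ} (i : Fin n) : F n := gen (Sum.inr i)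

/-- The relators of `𝓗(n)`, written in the free group; the first block of letters stands for
`x_1, …, x_n` and the second block for `y_1, …, y_n`. -/
def relators (n : ℕ) : Set (F n) :=
  {w | ∃ z : Letter n, w = gen z ^ 2} ∪
  {w | ∃ i j : Fin n, w = comm (a i) (a j)} ∪
  {w | ∃ i j : Fin n, w = comm (b i) (b j)} ∪
  {w | ∃ i j : Fin n, w = comm (a i) (b j) ^ 2} ∪
  {w | ∃ i j k : Fin n, w = comm (comm (b i) (a j)) (b k)} ∪
  {w | ∃ (i j : Fin n) (z : Letter n), w = comm (comm (a i) (b j)) (gen z) ^ 2} ∪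
  {w | ∃ z₁ z₂ z₃ z₄ : Letter n,
    w = comm (comm (comm (gen z₁) (gen z₂)) (gen z₃)) (gen z₄)}

/-- The group `𝓗(n)`, given by generators and relations. -/
abbrev H (n : ℕ) : Type := PresentedGroup (relators n)

/-- The generator `x_i` of `𝓗(n)`. -/
def x {n : ℕ} (i : Fin n) : H n := PresentedGroup.of (Sum.inl i)

/-- The generator `y_i` of `𝓗(n)`. -/
def y {n : ℕ} (i : Fin n) : H n := PresentedGroup.of (Sum.inr i)

/-- The subgroup `K = ⟨F₄, a_i², [a_i,a_j]², [[a_i,a_j],a_k]², [[a_i,a_j],a_i]⟩` of `F`, with all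
indices running over the whole alphabet. Mathlib numbers the lower central series from `0`, so
that `F₁ = F` is the term of index `0` and `F₄` the term of index `3`. -/
def K (n : ℕ) : Subgroup (F n) :=
  Subgroup.closure (
    ((Subgroup.lowerCentralSeries (⊤ : Subgroup (F n)) 3 : Subgroup (F n)) : Set (F n)) ∪
    {w | ∃ z : Letter n, w = gen z ^ 2} ∪
    {w | ∃ z₁ z₂ : Letter n, w = comm (gen z₁) (gen z₂) ^ 2} ∪
    {w | ∃ z₁ z₂ z₃ : Letter n, w = comm (comm (gen z₁) (gen z₂)) (gen z₃) ^ 2} ∪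
    {w | ∃ z₁ z₂ : Letter n, w = comm (comm (gen z₁) (gen z₂)) (gen z₁)})

/-- The subgroup `I` of `F` generated by `K` and the commutators `[a,a']`, `[b,b']`, `[[a,a'],c]`,
`[[b,b'],c]`, `[[b,a],b']`, for `a, a'` in the first block, `b, b'` in the second block and `c` any
generator. (It is the subgroup generated by these elements, not their normal closure.) -/
def I (n : ℕ) : Subgroup (F n) :=
  Subgroup.closure (
    (K n : Set (F n)) ∪
    {w | ∃ i j : Fin n, w = comm (a i) (a j)} ∪
    {w | ∃ i j : Fin n, w = comm (b i) (b j)} ∪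
    {w | ∃ (i j : Fin n) (z : Letter n), w = comm (comm (a i) (a j)) (gen z)} ∪
    {w | ∃ (i j : Fin n) (z : Letter n), w = comm (comm (b i) (b j)) (gen z)} ∪
    {w | ∃ i j k : Fin n, w = comm (comm (b i) (a j)) (b k)})

/-- The smaller set `D_I` of elements of `F` which, together with `K`, generates `I`. -/
def D (n : ℕ) : Set (F n) :=
  {w | ∃ i j : Fin n, j < i ∧ w = comm (a i) (a j)} ∪
  {w | ∃ i j : Fin n, j < i ∧ w = comm (b i) (b j)} ∪
  {w | ∃ i j k : Fin n, j < i ∧ j < k ∧ k ≠ i ∧ w = comm (comm (a i) (a j)) (a k)} ∪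
  {w | ∃ i j l : Fin n, j < i ∧ w = comm (comm (a i) (a j)) (b l)} ∪
  {w | ∃ i j k : Fin n, j < i ∧ j < k ∧ k ≠ i ∧ w = comm (comm (b i) (b j)) (b k)} ∪
  {w | ∃ i j l : Fin n, j < i ∧ w = comm (comm (b i) (b j)) (a l)} ∪
  {w | ∃ i j l : Fin n, j < i ∧ w = comm (comm (b i) (a l)) (b j)}

/-- The elementary abelian group `C_2^m`, written multiplicatively. -/
abbrev C₂Pow (m : ℕ) : Type := Multiplicative (Fin m → ZMod 2)

/-- `G` is nilpotent, of nilpotency class exactly `c`. -/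
def HasNilpotencyClass (G : Type*) [Group G] (c : ℕ) : Prop :=
  ∃ _ : Group.IsNilpotent G, Group.nilpotencyClass G = c

end MixedDihedral

/-! The group `H n` is `F n` modulo the normal closure of the relators, so the isomorphism with `F n
⧸ I n` amounts to `normalClosure_relators`: that closure is `I n`. Both `K n` and `I n`, although
defined by plain generation, are normal: conjugating a generator by a letter multiplies it by
elements already present, up to terms of weight at least four. In the other direction, weight-four
commutators of generators vanish in `H n`, hence it has class at most three, and the relations
`[[z,z'],z] = 1` defining `K n` are automatic, because an involution `z` inverts `[z,z']`, which has
square one (`comm_comm_self_eq_one`).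

The sizes of `I/K` and `F'I/I` come from matching bounds. Upper bound: modulo `K n` weight-three
commutators of letters are central, symmetric in the first two entries, trivial on a repeated
letter, and satisfy the Jacobi identity; this reduces all generators to the lists `D n` and
`complementD n`. Since `[F',F'] ≤ F₄ ≤ K`, the sections are abelian, generated by involutions.

Lower bound: colour the letters by the superdiagonal elementary matrices of the unitriangular group
`UT4` over the field of two elements. All these homomorphisms kill `K n`, and those giving the
middle colour only to second-block letters, which receive no other nontrivial colour, kill `I n`. On
`F'K` the entries in positions 13 (for pairs) and 14 (for triples) are additive, and suitable
colourings give families exactly dual to the two lists. Counting indices gives the ranks; the order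
of `F/I` is the product of the indices of `I` in `F'I` and of `F'I` in `F`. -/

namespace MixedDihedral

open Subgroup

/-! ### Recognising elementary abelian 2-groups by dual characters -/

section Elementary

/-- An abelian group generated by involutions that admit a dual family of characters is
elementary abelian. -/
theorem nonempty_mulEquiv_of_dual {A ι : Type*} [CommGroup A] [Fintype ι] [DecidableEq ι]
    (e : ι → A) (he : closure (Set.range e) = ⊤) (he2 : ∀ i, e i ^ 2 = 1)
    (χ : A →* Multiplicative (ι → ZMod 2))
    (hχ : ∀ i, χ (e i) = Multiplicative.ofAdd (Pi.single i 1)) {m : ℕ}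
    (hm : Fintype.card ι = m) : Nonempty (A ≃* C₂Pow m) := by
  -- The characters are the coordinates: the expansion holds on generators and respects products and
  -- inverses. Injectivity of `χ` is then immediate.
  have key : ∀ x : A, x = ∏ i, e i ^ ((Multiplicative.toAdd (χ x)) i).val := by
    intro x
    have hx : x ∈ closure (Set.range e) := he ▸ mem_top x
    have hpow : ∀ (i : ι) (s t : ZMod 2), e i ^ (s + t).val = e i ^ s.val * e i ^ t.val := by
      intro i s t
      rw [ZMod.val_add, ← pow_add, ← pow_mod_orderOf, ← pow_mod_orderOf _ (s.val + t.val),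
        Nat.mod_mod_of_dvd _ (orderOf_dvd_of_pow_eq_one (he2 i))]
    have hmul : ∀ x y : A, x = ∏ i, e i ^ ((Multiplicative.toAdd (χ x)) i).val →
        y = ∏ i, e i ^ ((Multiplicative.toAdd (χ y)) i).val →
        x * y = ∏ i, e i ^ ((Multiplicative.toAdd (χ (x * y))) i).val := by
      intro x y h h'
      conv_lhs => rw [h, h', ← Finset.prod_mul_distrib]
      exact Finset.prod_congr rfl fun i _ => by rw [map_mul, toAdd_mul, Pi.add_apply, hpow]
    induction hx using closure_induction with
    | mem x hx =>
      obtain ⟨j, rfl⟩ := hx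
      rw [Finset.prod_eq_single j]
      · simp [hχ, ZMod.val_one]
      · intro i _ hij
        simp [hχ, hij]
      · simp
    | one => simp
    | mul x y _ _ h h' => exact hmul x y h h'
    | inv x _ h =>
      have h2 : ∀ i (s : ZMod 2), (e i ^ s.val)⁻¹ = e i ^ (-s).val := by
        intro i s
        rw [inv_eq_iff_mul_eq_one, ← hpow, add_neg_cancel, ZMod.val_zero, pow_zero]
      conv_lhs => rw [h, ← Finset.prod_inv_distrib]
      exact Finset.prod_congr rfl fun i _ => by rw [map_inv, toAdd_inv, Pi.neg_apply, h2]
  have hinj : Function.Injective χ := by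
    rw [injective_iff_map_eq_one]
    intro x hx
    rw [key x, hx]
    simp
  have hsurj : Function.Surjective χ := by
    intro v
    refine ⟨∏ i, e i ^ ((Multiplicative.toAdd v) i).val, ?_⟩
    rw [map_prod]
    apply Multiplicative.toAdd.injective
    rw [toAdd_prod]
    ext j
    simp [hχ, Pi.single_apply, -ZMod.natCast_val]
    exact ZMod.natCast_zmod_val _
  let E : Multiplicative (ι → ZMod 2) ≃* C₂Pow m :=
    AddEquiv.toMultiplicative ((LinearEquiv.funCongrLeft (ZMod 2) (ZMod 2)
      ((finCongr hm.symm).trans (Fintype.equivFin ι).symm)).toAddEquiv)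
  exact ⟨(MulEquiv.ofBijective χ ⟨hinj, hsurj⟩).trans E⟩

/-- The relative version of `nonempty_mulEquiv_of_dual`, for a section `M / N`. -/
theorem nonempty_quotient_mulEquiv_of_dual {G ι : Type*} [Group G] [Fintype ι] [DecidableEq ι]
    (N M : Subgroup G) [N.Normal] (hab : ⁅M, M⁆ ≤ N) (e : ι → G)
    (hM : M = closure ((N : Set G) ∪ Set.range e)) (he2 : ∀ i, e i ^ 2 ∈ N)
    (χ : ι → G → ZMod 2) (hmul : ∀ i, ∀ x ∈ M, ∀ y ∈ M, χ i (x * y) = χ i x + χ i y)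
    (hN : ∀ i, ∀ x ∈ N, χ i x = 0) (hχ : ∀ i j, χ i (e j) = if i = j then 1 else 0) {m : ℕ}
    (hm : Fintype.card ι = m) : Nonempty (M ⧸ N.subgroupOf M ≃* C₂Pow m) := by
  have hcomm : ∀ x y : M ⧸ N.subgroupOf M, x * y = y * x := by
    intro x y
    induction x using QuotientGroup.induction_on with | H x => ?_
    induction y using QuotientGroup.induction_on with | H y => ?_
    rw [← QuotientGroup.mk_mul, ← QuotientGroup.mk_mul, QuotientGroup.eq, mem_subgroupOf]
    simpa [commutatorElement_def, mul_assoc] using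
      hab (commutator_mem_commutator (inv_mem y.2) (inv_mem x.2))
  let _ : CommGroup (M ⧸ N.subgroupOf M) :=
    { (inferInstance : Group (M ⧸ N.subgroupOf M)) with mul_comm := hcomm }
  have heM : ∀ i, e i ∈ M := fun i => by
    rw [hM]; exact subset_closure (Or.inr ⟨i, rfl⟩)
  let χ₀ : M →* Multiplicative (ι → ZMod 2) :=
    MonoidHom.mk' (fun x => Multiplicative.ofAdd fun i => χ i x) (by
      intro x y
      apply Multiplicative.toAdd.injective
      funext i
      exact hmul i x x.2 y y.2)
  have hker : N.subgroupOf M ≤ χ₀.ker := by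
    intro x hx
    rw [MonoidHom.mem_ker]
    apply Multiplicative.toAdd.injective
    funext i
    exact hN i x (mem_subgroupOf.1 hx)
  refine nonempty_mulEquiv_of_dual
    (fun i => (QuotientGroup.mk (⟨e i, heM i⟩ : M) : M ⧸ N.subgroupOf M)) ?_ ?_
    (QuotientGroup.lift _ χ₀ hker) ?_ hm
  · rw [eq_top_iff]
    intro x _
    induction x using QuotientGroup.induction_on with | H x => ?_
    obtain ⟨x, hx⟩ := x
    have hx' : x ∈ closure ((N : Set G) ∪ Set.range e) := hM ▸ hx
    -- Membership in `M` is carried through the induction, since without it the class of `y` cannot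
    -- be formed.
    suffices h : ∀ (y : G) (_ : y ∈ closure ((N : Set G) ∪ Set.range e)), ∃ hy : y ∈ M,
        (QuotientGroup.mk (⟨y, hy⟩ : M) : M ⧸ N.subgroupOf M) ∈ closure (Set.range fun i =>
          (QuotientGroup.mk (⟨e i, heM i⟩ : M) : M ⧸ N.subgroupOf M)) from (h x hx').2
    intro y hy
    induction hy using closure_induction with
    | mem y hy =>
      refine ⟨hM ▸ subset_closure hy, ?_⟩
      rcases hy with hy | ⟨i, rfl⟩
      · rw [(QuotientGroup.eq_one_iff _).2 (mem_subgroupOf.2 hy)]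
        exact one_mem _
      · exact subset_closure ⟨i, rfl⟩
    | one => exact ⟨one_mem _, one_mem _⟩
    | mul y z _ _ h h' =>
      obtain ⟨h1, h2⟩ := h
      obtain ⟨h1', h2'⟩ := h'
      exact ⟨mul_mem h1 h1', mul_mem h2 h2'⟩
    | inv y _ h =>
      obtain ⟨h1, h2⟩ := h
      exact ⟨inv_mem h1, inv_mem h2⟩
  · intro i
    rw [← QuotientGroup.mk_pow, QuotientGroup.eq_one_iff, mem_subgroupOf]
    exact he2 i
  · intro j
    apply Multiplicative.toAdd.injective
    funext i
    change χ i (e j) = (Pi.single j 1 : ι → ZMod 2) i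
    rw [hχ, Pi.single_apply]

end Elementary

/-! ### The unitriangular group of degree four over the field of two elements -/

section Model

/-- The group of unitriangular `4 × 4` matrices over the field with two elements. -/
@[ext] structure UT4 where
  x12 : ZMod 2
  x23 : ZMod 2
  x34 : ZMod 2
  x13 : ZMod 2
  x24 : ZMod 2
  x14 : ZMod 2
deriving DecidableEq

namespace UT4

instance : Mul UT4 where
  mul u v := ⟨u.x12 + v.x12, u.x23 + v.x23, u.x34 + v.x34, u.x13 + v.x13 + u.x12 * v.x23,
    u.x24 + v.x24 + u.x23 * v.x34, u.x14 + v.x14 + u.x12 * v.x24 + u.x13 * v.x34⟩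

instance : One UT4 where one := ⟨0, 0, 0, 0, 0, 0⟩

instance : Inv UT4 where
  inv u := ⟨-u.x12, -u.x23, -u.x34, -u.x13 + u.x12 * u.x23, -u.x24 + u.x23 * u.x34,
    -u.x14 + u.x12 * u.x24 + u.x13 * u.x34 - u.x12 * u.x23 * u.x34⟩

theorem mul_def (u v : UT4) : u * v = ⟨u.x12 + v.x12, u.x23 + v.x23, u.x34 + v.x34,
    u.x13 + v.x13 + u.x12 * v.x23, u.x24 + v.x24 + u.x23 * v.x34,
    u.x14 + v.x14 + u.x12 * v.x24 + u.x13 * v.x34⟩ := rfl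

theorem one_def : (1 : UT4) = ⟨0, 0, 0, 0, 0, 0⟩ := rfl

theorem inv_def (u : UT4) : u⁻¹ = ⟨-u.x12, -u.x23, -u.x34, -u.x13 + u.x12 * u.x23,
    -u.x24 + u.x23 * u.x34,
    -u.x14 + u.x12 * u.x24 + u.x13 * u.x34 - u.x12 * u.x23 * u.x34⟩ := rfl

instance : Group UT4 := Group.ofLeftAxioms
  (by intro u v w; ext <;> simp only [mul_def] <;> ring)
  (by intro u; ext <;> simp [mul_def, one_def])
  (by intro u; ext <;> simp only [mul_def, one_def, inv_def] <;> ring)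

/-- The corner entry stays unevaluated: it is central and drops out of any further commutator. -/
theorem comm_eq (u v : UT4) : comm u v = ⟨0, 0, 0, u.x12 * v.x23 - v.x12 * u.x23,
    u.x23 * v.x34 - v.x23 * u.x34, (comm u v).x14⟩ := by
  ext <;> simp only [comm, mul_def, inv_def] <;> ring

theorem comm_comm_eq (u v w : UT4) : comm (comm u v) w = ⟨0, 0, 0, 0, 0,
    (u.x12 * v.x23 - v.x12 * u.x23) * w.x34 - w.x12 * (u.x23 * v.x34 - v.x23 * u.x34)⟩ := by
  rw [comm_eq u v]
  ext <;> simp only [comm, mul_def, inv_def] <;> ring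

theorem comm_comm_comm (u v w z : UT4) : comm (comm (comm u v) w) z = 1 := by
  rw [comm_comm_eq u v w]
  ext <;> simp only [comm, mul_def, inv_def, one_def] <;> ring

/-- The elementary matrices on the superdiagonal, preceded by the identity. -/
def letter : Fin 4 → UT4 :=
  ![1, ⟨1, 0, 0, 0, 0, 0⟩, ⟨0, 1, 0, 0, 0, 0⟩, ⟨0, 0, 1, 0, 0, 0⟩]

theorem letter_sq : ∀ i, letter i ^ 2 = 1 := by decide

theorem comm_letter_sq : ∀ i j, comm (letter i) (letter j) ^ 2 = 1 := by decide

theorem comm_letter_x14 : ∀ i j, (comm (letter i) (letter j)).x14 = 0 := by decide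

theorem comm_comm_letter_sq :
    ∀ i j k, comm (comm (letter i) (letter j)) (letter k) ^ 2 = 1 := by decide

theorem comm_comm_letter_self :
    ∀ i j, comm (comm (letter i) (letter j)) (letter i) = 1 := by decide

theorem comm_letter_x13 : ∀ i j, (comm (letter i) (letter j)).x13 =
    if i = 1 ∧ j = 2 ∨ i = 2 ∧ j = 1 then 1 else 0 := by decide

theorem comm_comm_letter_x14 : ∀ i j k, (comm (comm (letter i) (letter j)) (letter k)).x14 =
    if (i = 1 ∧ j = 2 ∨ i = 2 ∧ j = 1) ∧ k = 3 ∨ (i = 2 ∧ j = 3 ∨ i = 3 ∧ j = 2) ∧ k = 1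
    then 1 else 0 := by decide

end UT4

end Model

/-! ### Commutator calculus and central series -/

section Nilpotent

variable {G G' : Type*} [Group G] [Group G']

theorem map_comm (f : G →* G') (u v : G) : f (comm u v) = comm (f u) (f v) := by
  simp [comm]

theorem comm_eq_one_iff {u v : G} : comm u v = 1 ↔ u * v = v * u := by
  rw [comm, mul_assoc, ← mul_inv_rev, inv_mul_eq_one, eq_comm]

theorem conj_eq_mul_comm (u v : G) : v⁻¹ * u * v = u * comm u v := by
  simp [comm, mul_assoc]

theorem comm_inv (u v : G) : (comm u v)⁻¹ = comm v u := by
  simp [comm, mul_assoc]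

theorem comm_mem_commutator (u v : G) : comm u v ∈ commutator G := by
  have : comm u v = u⁻¹ * v⁻¹ * (u⁻¹)⁻¹ * (v⁻¹)⁻¹ := by simp [comm]
  rw [this]
  exact commutator_mem_commutator (mem_top _) (mem_top _)

theorem comm_mem_lowerCentralSeries_succ {k : ℕ} {u : G}
    (hu : u ∈ (⊤ : Subgroup G).lowerCentralSeries k) (v : G) :
    comm u v ∈ (⊤ : Subgroup G).lowerCentralSeries (k + 1) := by
  have : comm u v = u⁻¹ * v⁻¹ * (u⁻¹)⁻¹ * (v⁻¹)⁻¹ := by simp [comm]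
  rw [this, Subgroup.lowerCentralSeries_succ]
  exact commutator_mem_commutator (inv_mem hu) (mem_top _)

theorem comm_comm_comm_mem (u v w z : G) :
    comm (comm (comm u v) w) z ∈ (⊤ : Subgroup G).lowerCentralSeries 3 :=
  comm_mem_lowerCentralSeries_succ (comm_mem_lowerCentralSeries_succ
    (comm_mem_lowerCentralSeries_succ (k := 0) (mem_top u) v) w) z

/-- Modulo the `k`-th centre the centralizer of `u` is a subgroup, so it is everything once it
contains the generators. -/
theorem mem_upperCentralSeries_succ_of_closure {S : Set G} (hS : closure S = ⊤) {k : ℕ} {u : G}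
    (h : ∀ z ∈ S, comm u z ∈ Subgroup.upperCentralSeries G k) : u ∈ Subgroup.upperCentralSeries G (k + 1) := by
  have hle : (⊤ : Subgroup G) ≤ (centralizer {QuotientGroup.mk' (Subgroup.upperCentralSeries G k) u}).comap
      (QuotientGroup.mk' (Subgroup.upperCentralSeries G k)) := by
    rw [← hS, closure_le]
    intro z hz
    have h1 := (QuotientGroup.eq_one_iff (N := Subgroup.upperCentralSeries G k) _).2 (h z hz)
    change QuotientGroup.mk' (Subgroup.upperCentralSeries G k) _ = 1 at h1
    rw [map_comm, comm_eq_one_iff] at h1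
    simpa [mem_centralizer_iff] using h1
  rw [Subgroup.mem_upperCentralSeries_succ_iff]
  intro y
  have h1 := hle (mem_top y)
  rw [mem_comap, mem_centralizer_singleton_iff] at h1
  rw [← QuotientGroup.eq_one_iff]
  change QuotientGroup.mk' (Subgroup.upperCentralSeries G k) (u * y * u⁻¹ * y⁻¹) = 1
  rw [map_mul, map_mul, map_mul, map_inv, map_inv, mul_inv_eq_one, mul_inv_eq_iff_eq_mul, h1]

/-- A group is nilpotent of class at most three as soon as the left-normed commutators of weight
four in its generators are trivial. -/
theorem lowerCentralSeries_three_eq_bot {S : Set G} (hS : closure S = ⊤)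
    (h : ∀ u ∈ S, ∀ v ∈ S, ∀ w ∈ S, ∀ z ∈ S, comm (comm (comm u v) w) z = 1) :
    (⊤ : Subgroup G).lowerCentralSeries 3 = ⊥ := by
  rw [Subgroup.lowerCentralSeries_eq_bot_iff_upperCentralSeries_eq_top, eq_top_iff, ← hS, closure_le]
  intro u hu
  refine mem_upperCentralSeries_succ_of_closure hS fun v hv =>
    mem_upperCentralSeries_succ_of_closure hS fun w hw =>
    mem_upperCentralSeries_succ_of_closure hS fun z hz => ?_
  rw [h u hu v hv w hw z hz]
  exact one_mem _

theorem lowerCentralSeries_le_ker (f : G →* G') {k : ℕ}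
    (h : Subgroup.lowerCentralSeries (⊤ : Subgroup G') k = ⊥) :
    (⊤ : Subgroup G).lowerCentralSeries k ≤ f.ker := by
  rw [← Subgroup.map_eq_bot_iff, eq_bot_iff, ← h, Subgroup.map_lowerCentralSeries]
  exact Subgroup.lowerCentralSeries_mono k le_top

/-- The three subgroups lemma, applied to `G`, `G` and `G'`. -/
theorem commutator_commutator_eq_bot (h : (⊤ : Subgroup G).lowerCentralSeries 3 = ⊥) :
    ⁅commutator G, commutator G⁆ = ⊥ := by
  have h' : ⁅⁅commutator G, (⊤ : Subgroup G)⁆, (⊤ : Subgroup G)⁆ = ⊥ := h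
  refine Subgroup.commutator_commutator_eq_bot_of_rotate (H₁ := ⊤) (H₂ := ⊤) ?_ h'
  rwa [Subgroup.commutator_comm ⊤ (commutator G)]

/-- The class-three case, applied to the quotient by the fourth term of the lower central series. -/
theorem commutator_commutator_le :
    ⁅commutator G, commutator G⁆ ≤ (⊤ : Subgroup G).lowerCentralSeries 3 := by
  set N := (⊤ : Subgroup G).lowerCentralSeries 3 with hN
  have hmap : ∀ k, (⊤ : Subgroup (G ⧸ N)).lowerCentralSeries k =
      ((⊤ : Subgroup G).lowerCentralSeries k).map (QuotientGroup.mk' N) := by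
    intro k
    rw [Subgroup.map_lowerCentralSeries, Subgroup.map_top_of_surjective _
      (QuotientGroup.mk'_surjective N)]
  have h1 := commutator_commutator_eq_bot (G := G ⧸ N) (by
    rw [hmap, Subgroup.map_eq_bot_iff, QuotientGroup.ker_mk'])
  rw [← Subgroup.top_lowerCentralSeries_one, hmap, ← Subgroup.map_commutator,
    Subgroup.map_eq_bot_iff, QuotientGroup.ker_mk', Subgroup.top_lowerCentralSeries_one] at h1
  exact h1

end Nilpotent

/-! ### Normality and derived subgroup tested on free generators -/

section FreeGroup

/-- A subgroup of a free group that contains the squares of the generators is normal if it contains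
the conjugates of its own generators by the free generators. -/
theorem normal_closure_of_sq_mem {α : Type*} {T : Set (FreeGroup α)}
    (h2 : ∀ z, FreeGroup.of z ^ 2 ∈ closure T)
    (hc : ∀ s ∈ T, ∀ z, (FreeGroup.of z)⁻¹ * s * FreeGroup.of z ∈ closure T) :
    (closure T).Normal := by
  have hc' : ∀ z, ∀ s ∈ closure T, (FreeGroup.of z)⁻¹ * s * FreeGroup.of z ∈ closure T := by
    intro z s hs
    have : closure T ≤ (closure T).comap (MulAut.conj (FreeGroup.of z)⁻¹).toMonoidHom := by
      rw [closure_le]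
      intro s hs
      simpa using hc s hs z
    simpa using this hs
  have hc'' : ∀ z, ∀ s ∈ closure T, FreeGroup.of z * s * (FreeGroup.of z)⁻¹ ∈ closure T := by
    intro z s hs
    -- Conjugations by `z` and by its inverse differ by conjugation by `z ^ 2`, an element of the
    -- subgroup, so one direction suffices.
    have : FreeGroup.of z * s * (FreeGroup.of z)⁻¹ =
        FreeGroup.of z ^ 2 * ((FreeGroup.of z)⁻¹ * s * FreeGroup.of z) *
          (FreeGroup.of z ^ 2)⁻¹ := by
      group
    rw [this]
    exact mul_mem (mul_mem (h2 z) (hc' z s hs)) (inv_mem (h2 z))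
  refine ⟨fun s hs g => ?_⟩
  induction g using FreeGroup.induction_on generalizing s with
  | C1 => simpa using hs
  | of z => exact hc'' z s hs
  | inv_of z _ => simpa using hc' z s hs
  | mul x y hx hy =>
    have : x * y * s * (x * y)⁻¹ = x * (y * s * y⁻¹) * x⁻¹ := by group
    rw [this]
    exact hx _ (hy s hs)

theorem commutator_le_of_comm_mem {α : Type*} {N : Subgroup (FreeGroup α)} [N.Normal]
    (h : ∀ p q, comm (FreeGroup.of p) (FreeGroup.of q) ∈ N) : commutator (FreeGroup α) ≤ N := by
  have h1 : ∀ x y : FreeGroup α,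
      QuotientGroup.mk' N x * QuotientGroup.mk' N y =
        QuotientGroup.mk' N y * QuotientGroup.mk' N x := by
    have h0 : ∀ (p : α) (y : FreeGroup α), Commute (QuotientGroup.mk' N (FreeGroup.of p))
        (QuotientGroup.mk' N y) := by
      intro p y
      induction y using FreeGroup.induction_on with
      | C1 => simp
      | of q =>
        have := (QuotientGroup.eq_one_iff (N := N) _).2 (h p q)
        change QuotientGroup.mk' N _ = 1 at this
        rwa [map_comm, comm_eq_one_iff] at this
      | inv_of q hq => rw [map_inv]; exact hq.inv_right
      | mul x y hx hy => rw [map_mul]; exact hx.mul_right hy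
    intro x y
    change Commute _ _
    induction x using FreeGroup.induction_on with
    | C1 => simp
    | of q => exact h0 q y
    | inv_of q hq => rw [map_inv]; exact hq.inv_left
    | mul x y hx hy => rw [map_mul]; exact hx.mul_left hy
  rw [_root_.commutator_def, commutator_le]
  intro x _ y _
  rw [← QuotientGroup.eq_one_iff]
  change QuotientGroup.mk' N (x * y * x⁻¹ * y⁻¹) = 1
  rw [map_mul, map_mul, map_mul, map_inv, map_inv, mul_inv_eq_one, mul_inv_eq_iff_eq_mul, h1]

end FreeGroup

/-! ### Symmetry and the Jacobi identity in weight three -/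

section Relations

variable {G ι : Type*} [Group G]

/-- A family of involutions, any two of which generate a dihedral group of order dividing `8`, and
whose left-normed commutators of weight four vanish. -/
structure IsDihedralFamily (u : ι → G) : Prop where
  sq : ∀ p, u p ^ 2 = 1
  comm_sq : ∀ p q, comm (u p) (u q) ^ 2 = 1
  comm_comm_self : ∀ p q, comm (comm (u p) (u q)) (u p) = 1
  comm_comm_comm : ∀ p q r s, comm (comm (comm (u p) (u q)) (u r)) (u s) = 1

namespace IsDihedralFamily

variable {u : ι → G} (hu : IsDihedralFamily u)
include hu

theorem inv_eq (p : ι) : (u p)⁻¹ = u p := by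
  rw [inv_eq_iff_mul_eq_one, ← _root_.sq, hu.sq]

theorem comm_swap (p q : ι) : comm (u p) (u q) = comm (u q) (u p) := by
  rw [← comm_inv (u q) (u p), inv_eq_iff_mul_eq_one, ← _root_.sq, hu.comm_sq]

theorem conj_triple (p q r s : ι) :
    (u s)⁻¹ * comm (comm (u p) (u q)) (u r) * u s = comm (comm (u p) (u q)) (u r) := by
  rw [conj_eq_mul_comm, hu.comm_comm_comm, mul_one]

/-- The Jacobi identity, extracted from the Hall–Witt identity. -/
theorem jacobi (p q r : ι) : comm (comm (u p) (u q)) (u r) * comm (comm (u q) (u r)) (u p) *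
    comm (comm (u r) (u p)) (u q) = 1 := by
  -- The Hall–Witt identity, valid in every group. The inner inverses disappear because the letters
  -- are involutions, the outer conjugations because triple commutators commute with the letters.
  have hw : ((u q)⁻¹ * comm (comm (u p) (u q)⁻¹) (u r) * u q) *
      ((u r)⁻¹ * comm (comm (u q) (u r)⁻¹) (u p) * u r) *
      ((u p)⁻¹ * comm (comm (u r) (u p)⁻¹) (u q) * u p) = 1 := by
    simp [comm, mul_assoc]
  have hc : ∀ s t, comm (u s) (u t)⁻¹ = comm (u s) (u t) := fun s t => by rw [hu.inv_eq]
  rw [hc, hc, hc] at hw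
  rwa [hu.conj_triple, hu.conj_triple, hu.conj_triple] at hw

end IsDihedralFamily

end Relations

/-! ### Normality of `K n` and `I n` -/

section Normal

variable {n : ℕ}

theorem comm_comm_comm_mem_K (u v w z : F n) : comm (comm (comm u v) w) z ∈ K n :=
  subset_closure (by simp only [Set.mem_union]; left; left; left; left
                     exact comm_comm_comm_mem u v w z)

theorem lowerCentralSeries_le_K : (⊤ : Subgroup (F n)).lowerCentralSeries 3 ≤ K n :=
  fun _ h => subset_closure (Or.inl (Or.inl (Or.inl (Or.inl h))))

theorem gen_sq_mem_K (p : Letter n) : gen p ^ 2 ∈ K n :=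
  subset_closure (Or.inl (Or.inl (Or.inl (Or.inr ⟨p, rfl⟩))))

theorem comm_sq_mem_K (p q : Letter n) : comm (gen p) (gen q) ^ 2 ∈ K n :=
  subset_closure (Or.inl (Or.inl (Or.inr ⟨p, q, rfl⟩)))

theorem comm_comm_sq_mem_K (p q r : Letter n) : comm (comm (gen p) (gen q)) (gen r) ^ 2 ∈ K n :=
  subset_closure (Or.inl (Or.inr ⟨p, q, r, rfl⟩))

theorem comm_comm_self_mem_K (p q : Letter n) : comm (comm (gen p) (gen q)) (gen p) ∈ K n :=
  subset_closure (Or.inr ⟨p, q, rfl⟩)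

instance K_normal : (K n).Normal := by
  have h4 : ∀ (u v w z g : F n), g⁻¹ * comm (comm (comm u v) w) z * g ∈ K n := by
    intro u v w z g
    have hn : ((⊤ : Subgroup (F n)).lowerCentralSeries 3).Normal := inferInstance
    have := hn.conj_mem _ (comm_comm_comm_mem u v w z) g⁻¹
    rw [inv_inv] at this
    exact lowerCentralSeries_le_K this
  apply normal_closure_of_sq_mem gen_sq_mem_K
  rintro s ((((hs | ⟨p, rfl⟩) | ⟨p, q, rfl⟩) | ⟨p, q, r, rfl⟩) | ⟨p, q, rfl⟩) z
  · have hn : ((⊤ : Subgroup (F n)).lowerCentralSeries 3).Normal := inferInstance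
    have := hn.conj_mem _ hs (FreeGroup.of z)⁻¹
    rw [inv_inv] at this
    exact lowerCentralSeries_le_K this
  -- With `c = [p,z]` the conjugate is `(pc)² = p² c² [c,p] [[c,p],c]`. This is where the generators
  -- `[[a_i,a_j],a_i]` of `K n` are needed.
  · have : (gen z)⁻¹ * gen p ^ 2 * gen z = gen p ^ 2 * (comm (gen p) (gen z) ^ 2 *
        comm (comm (gen p) (gen z)) (gen p) *
          comm (comm (comm (gen p) (gen z)) (gen p)) (comm (gen p) (gen z))) := by
      simp only [comm, pow_two]; group
    change (gen z)⁻¹ * gen p ^ 2 * gen z ∈ K n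
    rw [this]
    exact mul_mem (gen_sq_mem_K p) (mul_mem (mul_mem (comm_sq_mem_K p z)
      (comm_comm_self_mem_K p z)) (comm_comm_comm_mem_K _ _ _ _))
  -- With `c = [p,q]` and `d = [c,z]`, `(cd)² = c² d² · d⁻¹[d,c]d`, and the last factor is a
  -- conjugate of an element of `F₄`.
  · have : (gen z)⁻¹ * comm (gen p) (gen q) ^ 2 * gen z = comm (gen p) (gen q) ^ 2 *
        (comm (comm (gen p) (gen q)) (gen z) ^ 2 * ((comm (comm (gen p) (gen q)) (gen z))⁻¹ *
          comm (comm (comm (gen p) (gen q)) (gen z)) (comm (gen p) (gen q)) *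
          comm (comm (gen p) (gen q)) (gen z))) := by
      generalize comm (gen p) (gen q) = c
      simp only [comm, pow_two]; group
    change (gen z)⁻¹ * comm (gen p) (gen q) ^ 2 * gen z ∈ K n
    rw [this]
    exact mul_mem (comm_sq_mem_K p q) (mul_mem (comm_comm_sq_mem_K p q z) (h4 _ _ _ _ _))
  · have : (gen z)⁻¹ * comm (comm (gen p) (gen q)) (gen r) ^ 2 * gen z =
        comm (comm (gen p) (gen q)) (gen r) ^ 2 * ((comm (comm (gen p) (gen q)) (gen r))⁻¹ *
          comm (comm (comm (gen p) (gen q)) (gen r)) (gen z) *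
          comm (comm (gen p) (gen q)) (gen r)) *
          comm (comm (comm (gen p) (gen q)) (gen r)) (gen z) := by
      generalize comm (comm (gen p) (gen q)) (gen r) = c
      simp only [comm, pow_two]; group
    change (gen z)⁻¹ * comm (comm (gen p) (gen q)) (gen r) ^ 2 * gen z ∈ K n
    rw [this]
    exact mul_mem (mul_mem (comm_comm_sq_mem_K p q r) (h4 _ _ _ _ _))
      (comm_comm_comm_mem_K _ _ _ _)
  · rw [conj_eq_mul_comm]
    exact mul_mem (comm_comm_self_mem_K p q) (comm_comm_comm_mem_K _ _ _ _)

theorem K_le_I : K n ≤ I n :=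
  fun _ h => subset_closure (Or.inl (Or.inl (Or.inl (Or.inl (Or.inl h)))))

theorem comm_a_a_mem_I (i j : Fin n) : comm (a i) (a j) ∈ I n :=
  subset_closure (Or.inl (Or.inl (Or.inl (Or.inl (Or.inr ⟨i, j, rfl⟩)))))

theorem comm_b_b_mem_I (i j : Fin n) : comm (b i) (b j) ∈ I n :=
  subset_closure (Or.inl (Or.inl (Or.inl (Or.inr ⟨i, j, rfl⟩))))

theorem comm_a_a_gen_mem_I (i j : Fin n) (z : Letter n) : comm (comm (a i) (a j)) (gen z) ∈ I n :=
  subset_closure (Or.inl (Or.inl (Or.inr ⟨i, j, z, rfl⟩)))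

theorem comm_b_b_gen_mem_I (i j : Fin n) (z : Letter n) : comm (comm (b i) (b j)) (gen z) ∈ I n :=
  subset_closure (Or.inl (Or.inr ⟨i, j, z, rfl⟩))

theorem comm_b_a_b_mem_I (i j k : Fin n) : comm (comm (b i) (a j)) (b k) ∈ I n :=
  subset_closure (Or.inr ⟨i, j, k, rfl⟩)

instance I_normal : (I n).Normal := by
  apply normal_closure_of_sq_mem fun z => K_le_I (gen_sq_mem_K z)
  rintro s (((((hs | ⟨i, j, rfl⟩) | ⟨i, j, rfl⟩) | ⟨i, j, r, rfl⟩) | ⟨i, j, r, rfl⟩) |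
    ⟨i, j, k, rfl⟩) z
  · have := (K_normal (n := n)).conj_mem _ hs (gen z)⁻¹
    rw [inv_inv] at this
    exact K_le_I this
  all_goals rw [conj_eq_mul_comm]
  · exact mul_mem (comm_a_a_mem_I i j) (comm_a_a_gen_mem_I i j z)
  · exact mul_mem (comm_b_b_mem_I i j) (comm_b_b_gen_mem_I i j z)
  · exact mul_mem (comm_a_a_gen_mem_I i j r) (K_le_I (comm_comm_comm_mem_K _ _ _ _))
  · exact mul_mem (comm_b_b_gen_mem_I i j r) (K_le_I (comm_comm_comm_mem_K _ _ _ _))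
  · exact mul_mem (comm_b_a_b_mem_I i j k) (K_le_I (comm_comm_comm_mem_K _ _ _ _))

end Normal

/-! ### Reduction to basic commutators modulo `K n` -/

section Generation

variable {n : ℕ}

theorem isDihedralFamily_mk_gen :
    IsDihedralFamily fun z : Letter n => QuotientGroup.mk' (K n) (gen z) where
  sq p := by rw [← map_pow]; exact (QuotientGroup.eq_one_iff _).2 (gen_sq_mem_K p)
  comm_sq p q := by
    rw [← map_comm, ← map_pow]; exact (QuotientGroup.eq_one_iff _).2 (comm_sq_mem_K p q)
  comm_comm_self p q := by
    simp only [← map_comm]; exact (QuotientGroup.eq_one_iff _).2 (comm_comm_self_mem_K p q)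
  comm_comm_comm p q r s := by
    simp only [← map_comm]; exact (QuotientGroup.eq_one_iff _).2 (comm_comm_comm_mem_K _ _ _ _)

theorem comm_mem_swap {J : Subgroup (F n)} {p q : Letter n} (h : comm (gen p) (gen q) ∈ J) :
    comm (gen q) (gen p) ∈ J := by
  rw [← comm_inv]; exact inv_mem h

theorem comm_mem_of_lt {J : Subgroup (F n)} (f : Fin n → Letter n)
    (h : ∀ i j, j < i → comm (gen (f i)) (gen (f j)) ∈ J) (i j : Fin n) :
    comm (gen (f i)) (gen (f j)) ∈ J := by
  rcases lt_trichotomy j i with hij | rfl | hij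
  · exact h i j hij
  · simp [comm]
  · exact comm_mem_swap (h j i hij)

variable {J : Subgroup (F n)} (hJ : K n ≤ J)
include hJ

theorem mem_of_mk_eq {s d : F n} (h : QuotientGroup.mk' (K n) s = QuotientGroup.mk' (K n) d)
    (hd : d ∈ J) : s ∈ J := by
  have h1 : d⁻¹ * s ∈ K n := QuotientGroup.eq.1 h.symm
  simpa using mul_mem hd (hJ h1)

theorem comm_comm_mem_swap {p q r : Letter n} (h : comm (comm (gen p) (gen q)) (gen r) ∈ J) :
    comm (comm (gen q) (gen p)) (gen r) ∈ J := by
  refine mem_of_mk_eq hJ ?_ h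
  simp only [map_comm]
  rw [isDihedralFamily_mk_gen.comm_swap q p]

/-- By the Jacobi identity modulo `K n`, two of the three rotations determine the third. -/
theorem comm_comm_mem_rotate {p q r : Letter n} (h : comm (comm (gen q) (gen r)) (gen p) ∈ J)
    (h' : comm (comm (gen r) (gen p)) (gen q) ∈ J) :
    comm (comm (gen p) (gen q)) (gen r) ∈ J := by
  refine mem_of_mk_eq hJ (d := (comm (comm (gen q) (gen r)) (gen p) *
    comm (comm (gen r) (gen p)) (gen q))⁻¹) ?_ (inv_mem (mul_mem h h'))
  simp only [map_comm, map_mul, map_inv]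
  rw [eq_inv_iff_mul_eq_one, ← mul_assoc]
  exact isDihedralFamily_mk_gen.jacobi p q r

theorem comm_comm_self_mem (p q : Letter n) : comm (comm (gen p) (gen q)) (gen p) ∈ J :=
  hJ (comm_comm_self_mem_K p q)

theorem comm_comm_self_mem' (p q : Letter n) : comm (comm (gen p) (gen q)) (gen q) ∈ J :=
  comm_comm_mem_swap hJ (comm_comm_self_mem hJ q p)

theorem comm_comm_gen_mem_of_lt (f : Fin n → Letter n) (z : Letter n)
    (h : ∀ i j, j < i → comm (comm (gen (f i)) (gen (f j))) (gen z) ∈ J) (i j : Fin n) :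
    comm (comm (gen (f i)) (gen (f j))) (gen z) ∈ J := by
  rcases lt_trichotomy j i with hij | rfl | hij
  · exact h i j hij
  · simp [comm]
  · exact comm_comm_mem_swap hJ (h j i hij)

/-- Hall's collection in weight three: symmetry orders the first two entries, repeated letters give
elements of `K n`, and Jacobi moves the least index out of the last place. -/
theorem comm_comm_mem_of_basic (f : Fin n → Letter n)
    (h : ∀ i j k, j < i → j < k → k ≠ i → comm (comm (gen (f i)) (gen (f j))) (gen (f k)) ∈ J)
    (i j k : Fin n) : comm (comm (gen (f i)) (gen (f j))) (gen (f k)) ∈ J := by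
  refine comm_comm_gen_mem_of_lt hJ f _ (fun i j hij => ?_) i j
  rcases eq_or_ne k i with rfl | hki
  · exact comm_comm_self_mem hJ _ _
  rcases lt_trichotomy j k with hjk | rfl | hjk
  · exact h i j k hij hjk hki
  · exact comm_comm_self_mem' hJ _ _
  · exact comm_comm_mem_rotate hJ (h j k i hjk (hjk.trans hij) hij.ne')
      (comm_comm_mem_swap hJ (h i k j (hjk.trans hij) hjk hij.ne))

end Generation

/-! ### Reduced generating sets of `I n` and of `F'I` -/

section Generators

variable {n : ℕ}

theorem I_eq_closure_D : I n = closure ((K n : Set (F n)) ∪ D n) := by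
  apply le_antisymm
  · set J := closure ((K n : Set (F n)) ∪ D n) with hJdef
    have hJ : K n ≤ J := fun _ h => subset_closure (Or.inl h)
    have hbba : ∀ i j l, comm (comm (b i) (b j)) (a l) ∈ J := fun i j l =>
      comm_comm_gen_mem_of_lt hJ Sum.inr (Sum.inl l) (fun i j hij => subset_closure
        (Or.inr (Or.inl (Or.inr ⟨i, j, l, hij, rfl⟩)))) i j
    refine (closure_le _).2 ?_
    rintro s (((((hs | ⟨i, j, rfl⟩) | ⟨i, j, rfl⟩) | ⟨i, j, k | l, rfl⟩) | ⟨i, j, l | k, rfl⟩) |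
      ⟨i, l, j, rfl⟩)
    · exact hJ hs
    · exact comm_mem_of_lt Sum.inl (fun i j hij => subset_closure
        (Or.inr (Or.inl (Or.inl (Or.inl (Or.inl (Or.inl (Or.inl ⟨i, j, hij, rfl⟩)))))))) i j
    · exact comm_mem_of_lt Sum.inr (fun i j hij => subset_closure
        (Or.inr (Or.inl (Or.inl (Or.inl (Or.inl (Or.inl (Or.inr ⟨i, j, hij, rfl⟩)))))))) i j
    · exact comm_comm_mem_of_basic hJ Sum.inl (fun i j k h1 h2 h3 => subset_closure
        (Or.inr (Or.inl (Or.inl (Or.inl (Or.inl (Or.inr ⟨i, j, k, h1, h2, h3, rfl⟩))))))) i j k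
    · exact comm_comm_gen_mem_of_lt hJ Sum.inl (Sum.inr l) (fun i j hij => subset_closure
        (Or.inr (Or.inl (Or.inl (Or.inl (Or.inr ⟨i, j, l, hij, rfl⟩)))))) i j
    · exact hbba i j l
    · exact comm_comm_mem_of_basic hJ Sum.inr (fun i j k h1 h2 h3 => subset_closure
        (Or.inr (Or.inl (Or.inl (Or.inr ⟨i, j, k, h1, h2, h3, rfl⟩))))) i j k
    · have hlt : ∀ i j, j < i → comm (comm (b i) (a l)) (b j) ∈ J := fun i j hij =>
        subset_closure (Or.inr (Or.inr ⟨i, j, l, hij, rfl⟩))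
      rcases lt_trichotomy j i with hij | rfl | hij
      · exact hlt i j hij
      · exact comm_comm_self_mem hJ _ _
      -- The wrongly ordered `[[b_i,a_l],b_j]` is, by Jacobi, expressed through `[[b_j,a_l],b_i]`
      -- and `[[b_j,b_i],a_l]`.
      · exact comm_comm_mem_rotate hJ (comm_comm_mem_swap hJ (hlt j i hij)) (hbba j i l)
  · refine (closure_le _).2 ?_
    rintro s (hs | ((((((⟨i, j, -, rfl⟩ | ⟨i, j, -, rfl⟩) | ⟨i, j, k, -, -, -, rfl⟩) |
      ⟨i, j, l, -, rfl⟩) | ⟨i, j, k, -, -, -, rfl⟩) | ⟨i, j, l, -, rfl⟩) | ⟨i, j, l, -, rfl⟩))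
    · exact K_le_I hs
    · exact comm_a_a_mem_I i j
    · exact comm_b_b_mem_I i j
    · exact comm_a_a_gen_mem_I i j _
    · exact comm_a_a_gen_mem_I i j _
    · exact comm_b_b_gen_mem_I i j _
    · exact comm_b_b_gen_mem_I i j _
    · exact comm_b_a_b_mem_I i l j

/-- Representatives of a basis of `F' I / I`. -/
def complementD (n : ℕ) : Set (F n) :=
  {w | ∃ i j : Fin n, w = comm (b i) (a j)} ∪
  {w | ∃ i j l : Fin n, j < i ∧ w = comm (comm (b l) (a j)) (a i)}

theorem commutator_sup_I_eq_closure :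
    commutator (F n) ⊔ I n = closure ((I n : Set (F n)) ∪ complementD n) := by
  set M := closure ((I n : Set (F n)) ∪ complementD n) with hM
  have hIM : I n ≤ M := fun _ h => subset_closure (Or.inl h)
  have hKM : K n ≤ M := K_le_I.trans hIM
  have hba : ∀ i j, comm (b i) (a j) ∈ M := fun i j =>
    subset_closure (Or.inr (Or.inl ⟨i, j, rfl⟩))
  have hbaa : ∀ l i k, comm (comm (b l) (a i)) (a k) ∈ M := by
    intro l i k
    have hlt : ∀ i j, j < i → comm (comm (b l) (a j)) (a i) ∈ M := fun i j hij =>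
      subset_closure (Or.inr (Or.inr ⟨i, j, l, hij, rfl⟩))
    rcases lt_trichotomy i k with h | rfl | h
    · exact hlt k i h
    · exact comm_comm_self_mem' hKM _ _
    · exact comm_comm_mem_rotate hKM (hIM (comm_a_a_gen_mem_I i k _))
        (comm_comm_mem_swap hKM (hlt i k h))
  -- Once `M` is normal, `F' ≤ M` needs checking only on commutators of letters.
  have hnormal : M.Normal := by
    apply normal_closure_of_sq_mem fun z => hKM (gen_sq_mem_K z)
    rintro s (hs | (⟨i, j, rfl⟩ | ⟨i, j, l, hij, rfl⟩)) z
    · have := (I_normal (n := n)).conj_mem _ hs (gen z)⁻¹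
      rw [inv_inv] at this
      exact hIM this
    · rw [conj_eq_mul_comm]
      refine mul_mem (hba i j) ?_
      rcases z with k | k
      · exact hbaa i j k
      · exact hIM (comm_b_a_b_mem_I i j k)
    · rw [conj_eq_mul_comm]
      exact mul_mem (hbaa l j i) (hKM (comm_comm_comm_mem_K _ _ _ _))
  apply le_antisymm
  · refine sup_le (commutator_le_of_comm_mem ?_) hIM
    rintro (i | i) (j | j)
    · exact hIM (comm_a_a_mem_I i j)
    · exact comm_mem_swap (hba j i)
    · exact hba i j
    · exact hIM (comm_b_b_mem_I i j)
  · refine (closure_le _).2 ?_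
    rintro s (hs | (⟨i, j, rfl⟩ | ⟨i, j, l, hij, rfl⟩))
    · exact mem_sup_right hs
    · exact mem_sup_left (comm_mem_commutator _ _)
    · exact mem_sup_left (comm_mem_commutator _ _)

theorem commutator_sup_I_eq : commutator (F n) ⊔ I n = commutator (F n) ⊔ K n := by
  apply le_antisymm
  · refine sup_le le_sup_left ((closure_le _).2 ?_)
    rintro s (((((hs | ⟨i, j, rfl⟩) | ⟨i, j, rfl⟩) | ⟨i, j, k, rfl⟩) | ⟨i, j, k, rfl⟩) |
      ⟨i, l, j, rfl⟩)
    · exact mem_sup_right hs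
    all_goals exact mem_sup_left (comm_mem_commutator _ _)
  · exact sup_le_sup_left K_le_I _

end Generators

/-! ### Homomorphisms that kill `K n` -/

section Kernel

variable {G : Type*} [Group G]

/-- The commutator is a product of the involution `u` and its conjugate by `v`, hence inverted by
`u`; having square one, it is centralized by `u`. So the presentation of `H n` need not list these
relations. -/
theorem comm_comm_self_eq_one {u v : G} (hu : u ^ 2 = 1) (huv : comm u v ^ 2 = 1) :
    comm (comm u v) u = 1 := by
  have h1 : comm u v * u⁻¹ * comm u v * u = 1 := by
    have hu' : u⁻¹ * u⁻¹ = 1 := by rw [← mul_inv_rev, ← sq, hu, inv_one]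
    calc comm u v * u⁻¹ * comm u v * u
        = u⁻¹ * v⁻¹ * u * v * (u⁻¹ * u⁻¹) * v⁻¹ * u * v * u := by simp only [comm, mul_assoc]
      _ = u⁻¹ * v⁻¹ * u ^ 2 * v * u := by rw [hu']; simp only [sq]; group
      _ = 1 := by rw [hu]; group
  calc comm (comm u v) u
      = (comm u v ^ 2)⁻¹ * (comm u v * u⁻¹ * comm u v * u) := by
        generalize comm u v = c
        simp only [comm, sq]; group
    _ = 1 := by rw [huv, h1]; simp

theorem K_le_ker {n : ℕ} {f : F n →* G} (hu : IsDihedralFamily fun z => f (gen z))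
    (hsq : ∀ p q r, comm (comm (f (gen p)) (f (gen q))) (f (gen r)) ^ 2 = 1)
    (h3 : (⊤ : Subgroup G).lowerCentralSeries 3 = ⊥) : K n ≤ f.ker := by
  refine (closure_le _).2 ?_
  rintro s ((((hs | ⟨p, rfl⟩) | ⟨p, q, rfl⟩) | ⟨p, q, r, rfl⟩) | ⟨p, q, rfl⟩)
  · exact lowerCentralSeries_le_ker f h3 hs
  all_goals
    rw [SetLike.mem_coe, MonoidHom.mem_ker]
    simp only [map_pow, map_comm]
  · exact hu.sq p
  · exact hu.comm_sq p q
  · exact hsq p q r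
  · exact hu.comm_comm_self p q

end Kernel

/-! ### Detecting commutators by coloured matrix representations -/

section Coloring

variable {n : ℕ}

/-- The homomorphism to `UT4` that sends each letter to the elementary matrix named by its colour,
colour `0` being sent to the identity. -/
def color (c : Letter n → Fin 4) : F n →* UT4 :=
  FreeGroup.lift fun z => UT4.letter (c z)

@[simp] theorem color_gen (c : Letter n → Fin 4) (z : Letter n) :
    color c (gen z) = UT4.letter (c z) := FreeGroup.lift_apply_of

theorem K_le_ker_color (c : Letter n → Fin 4) : K n ≤ (color c).ker := by
  apply K_le_ker
  · simp only [color_gen]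
    exact ⟨fun _ => UT4.letter_sq _, fun _ _ => UT4.comm_letter_sq _ _,
      fun _ _ => UT4.comm_comm_letter_self _ _, fun _ _ _ _ => UT4.comm_comm_comm _ _ _ _⟩
  · simp only [color_gen]
    exact fun _ _ _ => UT4.comm_comm_letter_sq _ _ _
  · exact lowerCentralSeries_three_eq_bot (S := Set.univ) (by simp)
      fun u _ v _ w _ z _ => UT4.comm_comm_comm u v w z

/-- Colours `1` and `3` name commuting matrices, so noncommuting letters always involve the middle
colour `2`. Under these restrictions letters of the same block commute, and `[[b,a],b']` vanishes
since a nonzero corner uses colour `2` only once. -/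
theorem I_le_ker_color (c : Letter n → Fin 4) (ha : ∀ i, c (Sum.inl i) ≠ 2)
    (hb : ∀ i, c (Sum.inr i) = 0 ∨ c (Sum.inr i) = 2) : I n ≤ (color c).ker := by
  have h1 : ∀ x y : Fin 4, x ≠ 2 → y ≠ 2 → comm (UT4.letter x) (UT4.letter y) = 1 := by decide
  have h2 : ∀ x y : Fin 4, x = 0 ∨ x = 2 → y = 0 ∨ y = 2 →
      comm (UT4.letter x) (UT4.letter y) = 1 := by decide
  have h3 : ∀ x y z : Fin 4, x = 0 ∨ x = 2 → y ≠ 2 → z = 0 ∨ z = 2 →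
      comm (comm (UT4.letter x) (UT4.letter y)) (UT4.letter z) = 1 := by decide
  have h4 : ∀ g : UT4, comm 1 g = 1 := fun g => by simp [comm]
  refine (closure_le _).2 ?_
  rintro s (((((hs | ⟨i, j, rfl⟩) | ⟨i, j, rfl⟩) | ⟨i, j, k, rfl⟩) | ⟨i, j, k, rfl⟩) |
    ⟨i, l, j, rfl⟩)
  · exact K_le_ker_color c hs
  all_goals
    rw [SetLike.mem_coe, MonoidHom.mem_ker]
    simp only [map_comm, color_gen]
  · exact h1 _ _ (ha i) (ha j)
  · exact h2 _ _ (hb i) (hb j)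
  · rw [h1 _ _ (ha i) (ha j), h4]
  · rw [h2 _ _ (hb i) (hb j), h4]
  · exact h3 _ _ _ (hb i) (ha l) (hb j)

/-- The superdiagonal entries are additive characters, so they kill commutators. Their vanishing
removes the cross terms that keep the 13 and 14 entries from being additive. -/
theorem color_superdiagonal (c : Letter n → Fin 4) {w : F n} (hw : w ∈ commutator (F n) ⊔ K n) :
    (color c w).x12 = 0 ∧ (color c w).x23 = 0 ∧ (color c w).x34 = 0 := by
  let S : Subgroup UT4 :=
    { carrier := {u | u.x12 = 0 ∧ u.x23 = 0 ∧ u.x34 = 0}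
      one_mem' := ⟨rfl, rfl, rfl⟩
      mul_mem' := by
        rintro u v ⟨h1, h2, h3⟩ ⟨h1', h2', h3'⟩
        simp [UT4.mul_def, h1, h2, h3, h1', h2', h3']
      inv_mem' := by
        rintro u ⟨h1, h2, h3⟩
        simp [UT4.inv_def, h1, h2, h3] }
  have hS : commutator (F n) ⊔ K n ≤ S.comap (color c) := by
    refine sup_le ?_ ((K_le_ker_color c).trans fun x hx => ?_)
    · rw [_root_.commutator_def, commutator_le]
      intro x _ y _
      change color c (x * y * x⁻¹ * y⁻¹) ∈ S
      simp only [map_mul, map_inv]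
      refine ⟨?_, ?_, ?_⟩ <;> simp only [UT4.mul_def, UT4.inv_def] <;> ring
    · rw [mem_comap, MonoidHom.mem_ker.1 hx]
      exact one_mem _
  exact hS hw

theorem color_x13_mul (c : Letter n → Fin 4) {w w' : F n} (hw : w ∈ commutator (F n) ⊔ K n) :
    (color c (w * w')).x13 = (color c w).x13 + (color c w').x13 := by
  obtain ⟨h1, -, -⟩ := color_superdiagonal c hw
  simp [map_mul, UT4.mul_def, h1]

theorem color_x14_mul (c : Letter n → Fin 4) {w w' : F n} (hw : w ∈ commutator (F n) ⊔ K n)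
    (hw' : w' ∈ commutator (F n) ⊔ K n) :
    (color c (w * w')).x14 = (color c w).x14 + (color c w').x14 := by
  obtain ⟨h1, -, -⟩ := color_superdiagonal c hw
  obtain ⟨-, -, h3⟩ := color_superdiagonal c hw'
  simp [map_mul, UT4.mul_def, h1, h3]

/-- The colouring that gives `u` and `v` the colours `1` and `2`. -/
def pairColoring (u v : Letter n) : Letter n → Fin 4 :=
  fun z => if z = u then 1 else if z = v then 2 else 0

/-- The colouring that gives `u`, `v` and `w` the colours `1`, `2` and `3`. -/
def tripleColoring (u v w : Letter n) : Letter n → Fin 4 :=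
  fun z => if z = u then 1 else if z = v then 2 else if z = w then 3 else 0

theorem color_pairColoring_comm {u v : Letter n} (huv : u ≠ v) (p q : Letter n) :
    (color (pairColoring u v) (comm (gen p) (gen q))).x13 =
      if p = u ∧ q = v ∨ p = v ∧ q = u then 1 else 0 := by
  have h1 : ∀ z, pairColoring u v z = 1 ↔ z = u := by
    intro z; unfold pairColoring; split_ifs <;> simp_all
  have h2 : ∀ z, pairColoring u v z = 2 ↔ z = v := by
    intro z; unfold pairColoring; split_ifs <;> simp_all
  rw [map_comm, color_gen, color_gen, UT4.comm_letter_x13]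
  simp only [h1, h2]

/-- The end letters `u` and `w` commute in the image. Of the three rotations of a triple commutator
in `u`, `v`, `w`, the one with `v` last has value zero and the other two have value one, in
accordance with Jacobi. -/
theorem color_tripleColoring_comm_comm {u v w : Letter n} (huv : u ≠ v) (huw : u ≠ w) (hvw : v ≠ w)
    (p q r : Letter n) :
    (color (tripleColoring u v w) (comm (comm (gen p) (gen q)) (gen r))).x14 =
      if (p = u ∧ q = v ∨ p = v ∧ q = u) ∧ r = w ∨ (p = v ∧ q = w ∨ p = w ∧ q = v) ∧ r = u
      then 1 else 0 := by
  have h1 : ∀ z, tripleColoring u v w z = 1 ↔ z = u := by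
    intro z; unfold tripleColoring; split_ifs <;> simp_all
  have h2 : ∀ z, tripleColoring u v w z = 2 ↔ z = v := by
    intro z; unfold tripleColoring; split_ifs <;> simp_all
  have h3 : ∀ z, tripleColoring u v w z = 3 ↔ z = w := by
    intro z; unfold tripleColoring; split_ifs <;> simp_all
  rw [map_comm, map_comm, color_gen, color_gen, color_gen, UT4.comm_comm_letter_x14]
  simp only [h1, h2, h3]

/-- With `color_comm_comm_x13`, this makes the functionals of one weight vanish on the listed
commutators of the other. -/
theorem color_comm_x14 (c : Letter n → Fin 4) (p q : Letter n) :
    (color c (comm (gen p) (gen q))).x14 = 0 := by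
  rw [map_comm, color_gen, color_gen, UT4.comm_letter_x14]

theorem color_comm_comm_x13 (c : Letter n → Fin 4) (u v w : F n) :
    (color c (comm (comm u v) w)).x13 = 0 := by
  rw [map_comm, map_comm, UT4.comm_comm_eq]

end Coloring

/-! ### Dual bases and the ranks of `F'I/I` and `I/K` -/

section Sections

variable {n : ℕ}

theorem commutator_sup_K_commutator_le :
    ⁅commutator (F n) ⊔ K n, commutator (F n) ⊔ K n⁆ ≤ K n := by
  have h : ⁅commutator (F n), commutator (F n)⁆ ≤ K n :=
    commutator_commutator_le.trans lowerCentralSeries_le_K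
  have hK : (K n).map (QuotientGroup.mk' (K n)) = ⊥ := by
    rw [Subgroup.map_eq_bot_iff, QuotientGroup.ker_mk']
  have h' : ⁅commutator (F n) ⊔ K n, commutator (F n) ⊔ K n⁆.map (QuotientGroup.mk' (K n)) = ⊥ := by
    rw [map_commutator, Subgroup.map_sup, hK, sup_bot_eq, ← map_commutator,
      Subgroup.map_eq_bot_iff, QuotientGroup.ker_mk']
    exact h
  rwa [Subgroup.map_eq_bot_iff, QuotientGroup.ker_mk'] at h'

/-- Pairs of indices in decreasing order. -/
abbrev DecPair (n : ℕ) : Type := {p : Fin n × Fin n // p.2 < p.1}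

/-- Triples of distinct indices whose second entry is the least. -/
abbrev BasicTriple (n : ℕ) : Type :=
  {t : Fin n × Fin n × Fin n // t.2.1 < t.1 ∧ t.2.1 < t.2.2 ∧ t.2.2 ≠ t.1}

theorem card_decPair (n : ℕ) : 2 * Fintype.card (DecPair n) + n = n ^ 2 := by
  have h1 : Fintype.card (DecPair n) = ∑ i : Fin n, (i : ℕ) := by
    rw [Fintype.card_congr (Equiv.subtypeProdEquivSigmaSubtype fun i j : Fin n => j < i),
      Fintype.card_sigma]
    refine Finset.sum_congr rfl fun i _ => ?_
    rw [Fintype.card_subtype, Finset.filter_gt_eq_Iio, Fin.card_Iio]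
  rw [h1, Fin.sum_univ_eq_sum_range (fun i => i), mul_comm, Finset.sum_range_id_mul_two]
  cases n with
  | zero => rfl
  | succ m => rw [Nat.add_sub_cancel]; ring

/-- Three indices form two such triples, so the count is `n(n-1)(n-2)/3`, stated here without
subtraction or division. The proof sums over the least index. -/
theorem card_basicTriple (n : ℕ) : 3 * Fintype.card (BasicTriple n) + 3 * n ^ 2 = n ^ 3 + 2 * n := by
  have e : BasicTriple n ≃ Σ j : Fin n, {p : Fin n × Fin n // p ∈ (Finset.Ioi j).offDiag} :=
    { toFun := fun t => ⟨t.1.2.1, (t.1.1, t.1.2.2), by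
        simpa using ⟨t.2.1, t.2.2.1, t.2.2.2.symm⟩⟩
      invFun := fun s => ⟨(s.2.1.1, s.1, s.2.1.2), by
        have := s.2.2
        simp only [Finset.mem_offDiag, Finset.mem_Ioi] at this
        exact ⟨this.1, this.2.1, this.2.2.symm⟩⟩
      left_inv := fun _ => rfl
      right_inv := fun _ => rfl }
  have h1 : Fintype.card (BasicTriple n) =
      ∑ j : Fin n, ((n - 1 - (j : ℕ)) * (n - 1 - (j : ℕ)) - (n - 1 - (j : ℕ))) := by
    rw [Fintype.card_congr e, Fintype.card_sigma]
    refine Finset.sum_congr rfl fun j _ => ?_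
    rw [Fintype.card_coe, Finset.offDiag_card, Fin.card_Ioi]
  have h2 : ∀ n : ℕ, 3 * ∑ m ∈ Finset.range n, (m * m - m) + 3 * n ^ 2 = n ^ 3 + 2 * n := by
    intro n
    induction n with
    | zero => rfl
    | succ m ih =>
      rw [Finset.sum_range_succ]
      have h3 : m ≤ m * m := Nat.le_mul_self m
      zify [h3] at ih ⊢
      linear_combination ih
  rw [h1, Fin.sum_univ_eq_sum_range (fun j => (n - 1 - j) * (n - 1 - j) - (n - 1 - j)),
    Finset.sum_range_reflect (fun m => m * m - m)]
  exact h2 n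

/-- The indices of the elements of `complementD n`. -/
abbrev ComplementIndex (n : ℕ) : Type := (Fin n × Fin n) ⊕ (DecPair n × Fin n)

/-- The enumeration of `complementD n`. -/
def complementElement : ComplementIndex n → F n
  | .inl (i, j) => comm (b i) (a j)
  | .inr (⟨(i, j), _⟩, l) => comm (comm (b l) (a j)) (a i)

/-- The functionals dual to `complementElement`. -/
def complementFunctional : ComplementIndex n → F n → ZMod 2
  | .inl (i, j) => fun w => (color (pairColoring (.inl j) (.inr i)) w).x13
  -- The second-block letter takes the middle colour, as killing `I n` requires. The other
  -- arrangement detected is `[[b_l,a_i],a_j]`, excluded from the list by `j < i`.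
  | .inr (⟨(i, j), _⟩, l) => fun w =>
      (color (tripleColoring (.inl j) (.inr l) (.inl i)) w).x14

theorem range_complementElement : Set.range (complementElement (n := n)) = complementD n := by
  ext w
  constructor
  · rintro ⟨⟨i, j⟩ | ⟨⟨⟨i, j⟩, h⟩, l⟩, rfl⟩
    · exact Or.inl ⟨i, j, rfl⟩
    · exact Or.inr ⟨i, j, l, h, rfl⟩
  · rintro (⟨i, j, rfl⟩ | ⟨i, j, l, h, rfl⟩)
    · exact ⟨.inl (i, j), rfl⟩
    · exact ⟨.inr (⟨(i, j), h⟩, l), rfl⟩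

theorem complementFunctional_eq_zero (s : ComplementIndex n) {w : F n} (hw : w ∈ I n) :
    complementFunctional s w = 0 := by
  rcases s with ⟨i, j⟩ | ⟨⟨⟨i, j⟩, h⟩, l⟩
  · have := I_le_ker_color (pairColoring (.inl j) (.inr i))
      (by intro k; unfold pairColoring; split_ifs <;> simp_all)
      (by intro k; unfold pairColoring; split_ifs <;> simp_all) hw
    simp only [complementFunctional, MonoidHom.mem_ker.1 this]; rfl
  · have := I_le_ker_color (tripleColoring (.inl j) (.inr l) (.inl i))
      (by intro k; unfold tripleColoring; split_ifs <;> simp_all)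
      (by intro k; unfold tripleColoring; split_ifs <;> simp_all) hw
    simp only [complementFunctional, MonoidHom.mem_ker.1 this]; rfl

theorem complementFunctional_complementElement (s t : ComplementIndex n) :
    complementFunctional s (complementElement t) = if s = t then 1 else 0 := by
  rcases s with ⟨i, j⟩ | ⟨⟨⟨i, j⟩, h⟩, l⟩ <;> rcases t with ⟨i', j'⟩ | ⟨⟨⟨i', j'⟩, h'⟩, l'⟩
  · simp only [complementFunctional, complementElement]
    rw [color_pairColoring_comm (by simp)]
    refine if_congr ?_ rfl rfl
    simp; grind
  · simp [complementFunctional, complementElement, color_comm_comm_x13]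
  · simp [complementFunctional, complementElement, color_comm_x14]
  · simp only [complementFunctional, complementElement]
    rw [color_tripleColoring_comm_comm (by simp) (by simpa using h.ne) (by simp)]
    refine if_congr ?_ rfl rfl
    simp at h h' ⊢; grind

theorem nonempty_commutator_sup_I_quotient_mulEquiv :
    Nonempty (↥(commutator (F n) ⊔ I n) ⧸ (I n).subgroupOf (commutator (F n) ⊔ I n) ≃*
      C₂Pow ((n ^ 3 + n ^ 2) / 2)) := by
  refine nonempty_quotient_mulEquiv_of_dual _ _ ?_ complementElement ?_ ?_ complementFunctional
    ?_ (fun s w hw => complementFunctional_eq_zero s hw) complementFunctional_complementElement ?_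
  · rw [commutator_sup_I_eq]
    exact commutator_sup_K_commutator_le.trans K_le_I
  · rw [range_complementElement, commutator_sup_I_eq_closure]
  · rintro (⟨i, j⟩ | ⟨⟨⟨i, j⟩, h⟩, l⟩)
    · exact K_le_I (comm_sq_mem_K _ _)
    · exact K_le_I (comm_comm_sq_mem_K _ _ _)
  · rw [commutator_sup_I_eq]
    rintro (⟨i, j⟩ | ⟨⟨⟨i, j⟩, h⟩, l⟩) w hw w' hw'
    · exact color_x13_mul _ hw
    · exact color_x14_mul _ hw hw'
  · have h := card_decPair n
    simp only [Fintype.card_sum, Fintype.card_prod, Fintype.card_fin]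
    generalize Fintype.card (DecPair n) = c at h
    have : n ^ 3 + n ^ 2 = 2 * (n * n + c * n) := by nlinarith
    omega

/-- The indices of the elements of `D n`. -/
abbrev DIndex (n : ℕ) : Type :=
  (DecPair n ⊕ DecPair n) ⊕ (BasicTriple n ⊕ (DecPair n × Fin n)) ⊕
    (BasicTriple n ⊕ (DecPair n × Fin n)) ⊕ (DecPair n × Fin n)

/-- The enumeration of `D n`. -/
def DElement : DIndex n → F n
  | .inl (.inl ⟨(i, j), _⟩) => comm (a i) (a j)
  | .inl (.inr ⟨(i, j), _⟩) => comm (b i) (b j)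
  | .inr (.inl (.inl ⟨(i, j, k), _⟩)) => comm (comm (a i) (a j)) (a k)
  | .inr (.inl (.inr (⟨(i, j), _⟩, l))) => comm (comm (a i) (a j)) (b l)
  | .inr (.inr (.inl (.inl ⟨(i, j, k), _⟩))) => comm (comm (b i) (b j)) (b k)
  | .inr (.inr (.inl (.inr (⟨(i, j), _⟩, l)))) => comm (comm (b i) (b j)) (a l)
  | .inr (.inr (.inr (⟨(i, j), _⟩, l))) => comm (comm (b i) (a l)) (b j)

/-- The functionals dual to `DElement`. -/
def DFunctional : DIndex n → F n → ZMod 2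
  | .inl (.inl ⟨(i, j), _⟩) => fun w => (color (pairColoring (.inl i) (.inl j)) w).x13
  | .inl (.inr ⟨(i, j), _⟩) => fun w => (color (pairColoring (.inr i) (.inr j)) w).x13
  -- The middle colour goes to `i`, so `[[a_k,a_j],a_i]` has value zero; the other arrangement with
  -- value one ends in the least index `j` and is not basic.
  | .inr (.inl (.inl ⟨(i, j, k), _⟩)) => fun w =>
      (color (tripleColoring (.inl j) (.inl i) (.inl k)) w).x14
  | .inr (.inl (.inr (⟨(i, j), _⟩, l))) => fun w =>
      (color (tripleColoring (.inl j) (.inl i) (.inr l)) w).x14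
  | .inr (.inr (.inl (.inl ⟨(i, j, k), _⟩))) => fun w =>
      (color (tripleColoring (.inr j) (.inr i) (.inr k)) w).x14
  -- Here the order matters: with `b_j` in the middle, the other arrangement detected is
  -- `[[b_j,a_l],b_i]`, which is not listed. With `b_i` in the middle the listed `[[b_i,a_l],b_j]`
  -- would be detected.
  | .inr (.inr (.inl (.inr (⟨(i, j), _⟩, l)))) => fun w =>
      (color (tripleColoring (.inr i) (.inr j) (.inl l)) w).x14
  | .inr (.inr (.inr (⟨(i, j), _⟩, l))) => fun w =>
      (color (tripleColoring (.inr i) (.inl l) (.inr j)) w).x14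

theorem range_DElement : Set.range (DElement (n := n)) = D n := by
  ext w
  constructor
  · rintro ⟨(⟨⟨i, j⟩, h⟩ | ⟨⟨i, j⟩, h⟩) | (⟨⟨i, j, k⟩, h⟩ | ⟨⟨⟨i, j⟩, h⟩, l⟩) |
      (⟨⟨i, j, k⟩, h⟩ | ⟨⟨⟨i, j⟩, h⟩, l⟩) | ⟨⟨⟨i, j⟩, h⟩, l⟩, rfl⟩
    · exact Or.inl (Or.inl (Or.inl (Or.inl (Or.inl (Or.inl ⟨i, j, h, rfl⟩)))))
    · exact Or.inl (Or.inl (Or.inl (Or.inl (Or.inl (Or.inr ⟨i, j, h, rfl⟩)))))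
    · exact Or.inl (Or.inl (Or.inl (Or.inl (Or.inr ⟨i, j, k, h.1, h.2.1, h.2.2, rfl⟩))))
    · exact Or.inl (Or.inl (Or.inl (Or.inr ⟨i, j, l, h, rfl⟩)))
    · exact Or.inl (Or.inl (Or.inr ⟨i, j, k, h.1, h.2.1, h.2.2, rfl⟩))
    · exact Or.inl (Or.inr ⟨i, j, l, h, rfl⟩)
    · exact Or.inr ⟨i, j, l, h, rfl⟩
  · rintro ((((((⟨i, j, h, rfl⟩ | ⟨i, j, h, rfl⟩) | ⟨i, j, k, h1, h2, h3, rfl⟩) |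
      ⟨i, j, l, h, rfl⟩) | ⟨i, j, k, h1, h2, h3, rfl⟩) | ⟨i, j, l, h, rfl⟩) | ⟨i, j, l, h, rfl⟩)
    · exact ⟨.inl (.inl ⟨(i, j), h⟩), rfl⟩
    · exact ⟨.inl (.inr ⟨(i, j), h⟩), rfl⟩
    · exact ⟨.inr (.inl (.inl ⟨(i, j, k), h1, h2, h3⟩)), rfl⟩
    · exact ⟨.inr (.inl (.inr (⟨(i, j), h⟩, l))), rfl⟩
    · exact ⟨.inr (.inr (.inl (.inl ⟨(i, j, k), h1, h2, h3⟩))), rfl⟩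
    · exact ⟨.inr (.inr (.inl (.inr (⟨(i, j), h⟩, l)))), rfl⟩
    · exact ⟨.inr (.inr (.inr (⟨(i, j), h⟩, l))), rfl⟩

theorem DFunctional_eq_zero (s : DIndex n) {w : F n} (hw : w ∈ K n) : DFunctional s w = 0 := by
  have h : ∀ c : Letter n → Fin 4, color c w = 1 := fun c => K_le_ker_color c hw
  rcases s with (s | s) | (s | s) | (s | s) | s <;> simp only [DFunctional, h] <;> rfl

theorem DFunctional_mul (s : DIndex n) {w w' : F n} (hw : w ∈ commutator (F n) ⊔ K n)
    (hw' : w' ∈ commutator (F n) ⊔ K n) :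
    DFunctional s (w * w') = DFunctional s w + DFunctional s w' := by
  rcases s with (s | s) | (s | s) | (s | s) | s
  · exact color_x13_mul _ hw
  · exact color_x13_mul _ hw
  all_goals exact color_x14_mul _ hw hw'

theorem DFunctional_DElement (s t : DIndex n) :
    DFunctional s (DElement t) = if s = t then 1 else 0 := by
  rcases s with s | s <;> rcases t with t | t
  · rcases s with ⟨⟨i, j⟩, h⟩ | ⟨⟨i, j⟩, h⟩ <;> rcases t with ⟨⟨i', j'⟩, h'⟩ | ⟨⟨i', j'⟩, h'⟩ <;>
    · simp only [DFunctional, DElement]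
      rw [color_pairColoring_comm (by simpa using h.ne')]
      refine if_congr ?_ rfl rfl
      simp at h h' ⊢
      try grind
  · rcases s with ⟨⟨i, j⟩, h⟩ | ⟨⟨i, j⟩, h⟩ <;>
    rcases t with (⟨⟨i', j', k'⟩, h'⟩ | ⟨⟨⟨i', j'⟩, h'⟩, l'⟩) |
      (⟨⟨i', j', k'⟩, h'⟩ | ⟨⟨⟨i', j'⟩, h'⟩, l'⟩) | ⟨⟨⟨i', j'⟩, h'⟩, l'⟩ <;>
    simp [DFunctional, DElement, color_comm_comm_x13]
  · rcases s with (⟨⟨i, j, k⟩, h⟩ | ⟨⟨⟨i, j⟩, h⟩, l⟩) |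
      (⟨⟨i, j, k⟩, h⟩ | ⟨⟨⟨i, j⟩, h⟩, l⟩) | ⟨⟨⟨i, j⟩, h⟩, l⟩ <;>
    rcases t with ⟨⟨i', j'⟩, h'⟩ | ⟨⟨i', j'⟩, h'⟩ <;>
    simp [DFunctional, DElement, color_comm_x14]
  · rcases s with (⟨⟨i, j, k⟩, h⟩ | ⟨⟨⟨i, j⟩, h⟩, l⟩) |
      (⟨⟨i, j, k⟩, h⟩ | ⟨⟨⟨i, j⟩, h⟩, l⟩) | ⟨⟨⟨i, j⟩, h⟩, l⟩ <;>
    rcases t with (⟨⟨i', j', k'⟩, h'⟩ | ⟨⟨⟨i', j'⟩, h'⟩, l'⟩) |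
      (⟨⟨i', j', k'⟩, h'⟩ | ⟨⟨⟨i', j'⟩, h'⟩, l'⟩) | ⟨⟨⟨i', j'⟩, h'⟩, l'⟩ <;>
    · simp only [DFunctional, DElement]
      rw [color_tripleColoring_comm_comm (by simp at h ⊢; try grind) (by simp at h ⊢; try grind)
        (by simp at h ⊢; try grind)]
      refine if_congr ?_ rfl rfl
      simp at h h' ⊢
      try grind

theorem I_le_commutator_sup_K : I n ≤ commutator (F n) ⊔ K n := by
  rw [← commutator_sup_I_eq]
  exact le_sup_right

theorem nonempty_I_quotient_mulEquiv (hn : 2 ≤ n) :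
    Nonempty (I n ⧸ (K n).subgroupOf (I n) ≃* C₂Pow ((13 * n ^ 3 - 15 * n ^ 2 + 2 * n) / 6)) := by
  refine nonempty_quotient_mulEquiv_of_dual _ _ ?_ DElement ?_ ?_ DFunctional
    (fun s w hw w' hw' => DFunctional_mul s (I_le_commutator_sup_K hw) (I_le_commutator_sup_K hw'))
    (fun s w hw => DFunctional_eq_zero s hw) DFunctional_DElement ?_
  · exact (commutator_mono I_le_commutator_sup_K I_le_commutator_sup_K).trans
      commutator_sup_K_commutator_le
  · rw [range_DElement, ← I_eq_closure_D]
  · rintro ((s | s) | (s | s) | (s | s) | s)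
    · exact comm_sq_mem_K _ _
    · exact comm_sq_mem_K _ _
    all_goals exact comm_comm_sq_mem_K _ _ _
  · have h := card_decPair n
    have h' := card_basicTriple n
    simp only [Fintype.card_sum, Fintype.card_prod, Fintype.card_fin]
    generalize Fintype.card (DecPair n) = c at h
    generalize Fintype.card (BasicTriple n) = d at h'
    have h2 : 2 * (c * n) + n ^ 2 = n ^ 3 := by nlinarith
    -- This makes the natural-number subtraction of `15 * n ^ 2` from `13 * n ^ 3` a genuine one.
    have h3 : 2 * n ^ 2 ≤ n ^ 3 := by
      rw [pow_succ' n 2]; exact Nat.mul_le_mul_right _ hn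
    omega

end Sections

/-! ### Nilpotency class from the lower central series -/

section NilpotencyClass

variable {G G' : Type*} [Group G] [Group G']

theorem lowerCentralSeries_eq_bot_of_surjective {f : G →* G'} (hf : Function.Surjective f) {k : ℕ}
    (h : (⊤ : Subgroup G).lowerCentralSeries k = ⊥) :
    (⊤ : Subgroup G').lowerCentralSeries k = ⊥ := by
  rw [← Subgroup.map_top_of_surjective f hf, ← Subgroup.map_lowerCentralSeries, h, Subgroup.map_bot]

theorem hasNilpotencyClass_succ {c : ℕ} (h : (⊤ : Subgroup G).lowerCentralSeries (c + 1) = ⊥)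
    (h' : (⊤ : Subgroup G).lowerCentralSeries c ≠ ⊥) : HasNilpotencyClass G (c + 1) := by
  have hG : Group.IsNilpotent G := Subgroup.nilpotent_iff_lowerCentralSeries.2 ⟨_, h⟩
  refine ⟨hG, le_antisymm (Subgroup.lowerCentralSeries_eq_bot_iff_nilpotencyClass_le.1 h) ?_⟩
  by_contra hlt
  exact h' (Subgroup.lowerCentralSeries_eq_bot_iff_nilpotencyClass_le.2 (by omega))

end NilpotencyClass

/-! ### The presented group is `F n ⧸ I n` -/

section Presentation

variable {n : ℕ}

theorem mk_gen_sq (p : Letter n) : PresentedGroup.mk (relators n) (gen p) ^ 2 = 1 := by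
  rw [← map_pow]
  exact PresentedGroup.one_of_mem (Or.inl (Or.inl (Or.inl (Or.inl (Or.inl (Or.inl ⟨p, rfl⟩))))))

theorem mk_comm_a_a (i j : Fin n) : comm (PresentedGroup.mk (relators n) (a i))
    (PresentedGroup.mk (relators n) (a j)) = 1 := by
  rw [← map_comm]
  exact PresentedGroup.one_of_mem (Or.inl (Or.inl (Or.inl (Or.inl (Or.inl (Or.inr ⟨i, j, rfl⟩))))))

theorem mk_comm_b_b (i j : Fin n) : comm (PresentedGroup.mk (relators n) (b i))
    (PresentedGroup.mk (relators n) (b j)) = 1 := by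
  rw [← map_comm]
  exact PresentedGroup.one_of_mem (Or.inl (Or.inl (Or.inl (Or.inl (Or.inr ⟨i, j, rfl⟩)))))

theorem mk_comm_a_b_sq (i j : Fin n) : comm (PresentedGroup.mk (relators n) (a i))
    (PresentedGroup.mk (relators n) (b j)) ^ 2 = 1 := by
  rw [← map_comm, ← map_pow]
  exact PresentedGroup.one_of_mem (Or.inl (Or.inl (Or.inl (Or.inr ⟨i, j, rfl⟩))))

theorem mk_comm_comm_b_a_b (i j k : Fin n) : comm (comm (PresentedGroup.mk (relators n) (b i))
    (PresentedGroup.mk (relators n) (a j))) (PresentedGroup.mk (relators n) (b k)) = 1 := by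
  simp only [← map_comm]
  exact PresentedGroup.one_of_mem (Or.inl (Or.inl (Or.inr ⟨i, j, k, rfl⟩)))

theorem mk_comm_comm_a_b_sq (i j : Fin n) (z : Letter n) :
    comm (comm (PresentedGroup.mk (relators n) (a i)) (PresentedGroup.mk (relators n) (b j)))
      (PresentedGroup.mk (relators n) (gen z)) ^ 2 = 1 := by
  simp only [← map_comm, ← map_pow]
  exact PresentedGroup.one_of_mem (Or.inl (Or.inr ⟨i, j, z, rfl⟩))

theorem isDihedralFamily_mk_relators :
    IsDihedralFamily fun z : Letter n => PresentedGroup.mk (relators n) (gen z) := by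
  have hsq : ∀ p q : Letter n, comm (PresentedGroup.mk (relators n) (gen p))
      (PresentedGroup.mk (relators n) (gen q)) ^ 2 = 1 := by
    rintro (i | i) (j | j)
    · rw [mk_comm_a_a, one_pow]
    · exact mk_comm_a_b_sq i j
    · rw [← comm_inv, inv_pow, mk_comm_a_b_sq, inv_one]
    · rw [mk_comm_b_b, one_pow]
  refine ⟨mk_gen_sq, hsq, fun p q => comm_comm_self_eq_one (mk_gen_sq p) (hsq p q),
    fun p q r s => ?_⟩
  simp only [← map_comm]
  exact PresentedGroup.one_of_mem (Or.inr ⟨p, q, r, s, rfl⟩)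

theorem lowerCentralSeries_H : (⊤ : Subgroup (H n)).lowerCentralSeries 3 = ⊥ := by
  refine lowerCentralSeries_three_eq_bot (PresentedGroup.closure_range_of (relators n)) ?_
  rintro _ ⟨p, rfl⟩ _ ⟨q, rfl⟩ _ ⟨r, rfl⟩ _ ⟨s, rfl⟩
  exact isDihedralFamily_mk_relators.comm_comm_comm p q r s

/-- Normality of `I n` gives one inclusion. For the other, `H n` has class at most three and its
generators form a dihedral family, so `K n` dies in `H n`; the remaining generators of `I n` are
relators or commutators with a trivial entry. -/
theorem normalClosure_relators : normalClosure (relators n) = I n := by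
  apply le_antisymm
  · refine normalClosure_le_normal ?_
    rintro s ((((((⟨z, rfl⟩ | ⟨i, j, rfl⟩) | ⟨i, j, rfl⟩) | ⟨i, j, rfl⟩) | ⟨i, j, k, rfl⟩) |
      ⟨i, j, z, rfl⟩) | ⟨p, q, r, s, rfl⟩)
    · exact K_le_I (gen_sq_mem_K z)
    · exact comm_a_a_mem_I i j
    · exact comm_b_b_mem_I i j
    · exact K_le_I (comm_sq_mem_K _ _)
    · exact comm_b_a_b_mem_I i j k
    · exact K_le_I (comm_comm_sq_mem_K _ _ _)
    · exact K_le_I (comm_comm_comm_mem_K _ _ _ _)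
  · suffices h : I n ≤ (PresentedGroup.mk (relators n)).ker from
      fun w hw => PresentedGroup.mk_eq_one_iff.1 (h hw)
    have h1 : ∀ g : H n, comm 1 g = 1 := fun g => by simp [comm]
    refine (closure_le _).2 ?_
    rintro s (((((hs | ⟨i, j, rfl⟩) | ⟨i, j, rfl⟩) | ⟨i, j, k, rfl⟩) | ⟨i, j, k, rfl⟩) |
      ⟨i, l, j, rfl⟩)
    · refine K_le_ker isDihedralFamily_mk_relators ?_ lowerCentralSeries_H hs
      rintro (i | i) (j | j) r
      · rw [mk_comm_a_a, h1, one_pow]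
      · exact mk_comm_comm_a_b_sq i j r
      · rw [isDihedralFamily_mk_relators.comm_swap (Sum.inr i) (Sum.inl j)]
        exact mk_comm_comm_a_b_sq j i r
      · rw [mk_comm_b_b, h1, one_pow]
    all_goals
      rw [SetLike.mem_coe, MonoidHom.mem_ker]
      simp only [map_comm]
    · exact mk_comm_a_a i j
    · exact mk_comm_b_b i j
    · rw [mk_comm_a_a, h1]
    · rw [mk_comm_b_b, h1]
    · exact mk_comm_comm_b_a_b i l j

/-- The identification of the presented group with `F / I`. -/
def mulEquivH (n : ℕ) : H n ≃* F n ⧸ I n :=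
  QuotientGroup.quotientMulEquivOfEq normalClosure_relators

theorem mulEquivH_mk (w : F n) :
    mulEquivH n (PresentedGroup.mk (relators n) w) = QuotientGroup.mk w := rfl

theorem lowerCentralSeries_quotient_I : (⊤ : Subgroup (F n ⧸ I n)).lowerCentralSeries 3 = ⊥ :=
  lowerCentralSeries_eq_bot_of_surjective (f := (mulEquivH n).toMonoidHom) (mulEquivH n).surjective
    lowerCentralSeries_H

theorem lowerCentralSeries_quotient_I_ne (hn : 2 ≤ n) :
    (⊤ : Subgroup (F n ⧸ I n)).lowerCentralSeries 2 ≠ ⊥ := by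
  intro h
  let i₀ : Fin n := ⟨0, by omega⟩
  let i₁ : Fin n := ⟨1, by omega⟩
  have hlt : i₀ < i₁ := by simp [i₀, i₁]
  -- A weight-three member of `complementD n`, available because `n ≥ 2`; its dual functional shows
  -- that it is not in `I n`.
  have h1 : comm (comm (b i₀) (a i₀)) (a i₁) ∈ I n := by
    rw [← QuotientGroup.eq_one_iff]
    change QuotientGroup.mk' (I n) _ = 1
    rw [← mem_bot, ← h, map_comm, map_comm]
    exact comm_mem_lowerCentralSeries_succ
      (comm_mem_lowerCentralSeries_succ (k := 0) (mem_top _) _) _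
  have h2 := complementFunctional_eq_zero (.inr (⟨(i₁, i₀), hlt⟩, i₀)) h1
  have h3 := complementFunctional_complementElement (n := n) (.inr (⟨(i₁, i₀), hlt⟩, i₀))
    (.inr (⟨(i₁, i₀), hlt⟩, i₀))
  rw [if_pos rfl] at h3
  exact one_ne_zero (h3.symm.trans h2)

end Presentation

/-! ### The abelianization and the order of `F n ⧸ I n` -/

section Abelianization

variable {n : ℕ}

/-- The abelianization of a quotient group. -/
theorem nonempty_abelianization_quotient_mulEquiv {G : Type*} [Group G] (N : Subgroup G)
    [N.Normal] : Nonempty (Abelianization (G ⧸ N) ≃* G ⧸ (commutator G ⊔ N)) := by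
  have h : commutator (G ⧸ N) = (commutator G ⊔ N).map (QuotientGroup.mk' N) := by
    have h1 : N.map (QuotientGroup.mk' N) = ⊥ := by
      rw [Subgroup.map_eq_bot_iff, QuotientGroup.ker_mk']
    rw [Subgroup.map_sup, h1, sup_bot_eq, _root_.commutator_def, _root_.commutator_def,
      map_commutator, Subgroup.map_top_of_surjective _ (QuotientGroup.mk'_surjective N)]
  exact ⟨(QuotientGroup.quotientMulEquivOfEq h).trans
    (QuotientGroup.quotientQuotientEquivQuotient N _ le_sup_right)⟩

/-- The dual characters are the exponent sums of the letters modulo two. They kill `F'K`, which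
equals `F'I`. -/
theorem nonempty_quotient_commutator_sup_I_mulEquiv :
    Nonempty (F n ⧸ (commutator (F n) ⊔ I n) ≃* C₂Pow (2 * n)) := by
  let χ : F n →* Multiplicative (Letter n → ZMod 2) :=
    FreeGroup.lift fun z => Multiplicative.ofAdd (Pi.single z 1)
  have hχ : ∀ z, χ (gen z) = Multiplicative.ofAdd (Pi.single z 1) :=
    fun z => FreeGroup.lift_apply_of
  have hsq : ∀ g : Multiplicative (Letter n → ZMod 2), g ^ 2 = 1 := by
    intro g
    apply Multiplicative.toAdd.injective
    funext z
    rw [sq]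
    exact CharTwo.add_self_eq_zero (Multiplicative.toAdd g z)
  have hcomm : ∀ g h : Multiplicative (Letter n → ZMod 2), comm g h = 1 :=
    fun g h => comm_eq_one_iff.2 (mul_comm g h)
  have hker : commutator (F n) ⊔ I n ≤ χ.ker := by
    rw [commutator_sup_I_eq]
    refine sup_le (Abelianization.commutator_subset_ker χ) (K_le_ker ?_ ?_ ?_)
    · exact ⟨fun _ => hsq _, fun _ _ => hsq _, fun _ _ => hcomm _ _, fun _ _ _ _ => hcomm _ _⟩
    · exact fun _ _ _ => hsq _
    · exact lowerCentralSeries_three_eq_bot (S := Set.univ) (by simp)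
        fun _ _ _ _ _ _ _ _ => hcomm _ _
  let _ : CommGroup (F n ⧸ (commutator (F n) ⊔ I n)) :=
    { (inferInstance : Group (F n ⧸ (commutator (F n) ⊔ I n))) with
      mul_comm := by
        intro x y
        induction x using QuotientGroup.induction_on with | H x => ?_
        induction y using QuotientGroup.induction_on with | H y => ?_
        have h := (QuotientGroup.eq_one_iff (N := commutator (F n) ⊔ I n) _).2
          (mem_sup_left (comm_mem_commutator x y))
        change QuotientGroup.mk' (commutator (F n) ⊔ I n) _ = 1 at h
        rw [map_comm, comm_eq_one_iff] at h
        exact h }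
  refine nonempty_mulEquiv_of_dual
    (fun z => (QuotientGroup.mk (gen z) : F n ⧸ (commutator (F n) ⊔ I n))) ?_ ?_
    (QuotientGroup.lift _ χ hker) hχ ?_
  · change closure (Set.range (QuotientGroup.mk' (commutator (F n) ⊔ I n) ∘ FreeGroup.of)) = ⊤
    rw [Set.range_comp, ← MonoidHom.map_closure, FreeGroup.closure_range_of,
      Subgroup.map_top_of_surjective _ (QuotientGroup.mk'_surjective _)]
  · intro z
    rw [← QuotientGroup.mk_pow, QuotientGroup.eq_one_iff]
    exact mem_sup_right (K_le_I (gen_sq_mem_K z))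
  · simp [two_mul]

theorem card_C₂Pow (m : ℕ) : Nat.card (C₂Pow m) = 2 ^ m := by
  rw [Nat.card_eq_fintype_card, Fintype.card_multiplicative, Fintype.card_pi]
  simp [ZMod.card]

theorem card_quotient_I : Nat.card (F n ⧸ I n) = 2 ^ ((n ^ 3 + n ^ 2 + 4 * n) / 2) := by
  obtain ⟨e⟩ := nonempty_quotient_commutator_sup_I_mulEquiv (n := n)
  obtain ⟨e'⟩ := nonempty_commutator_sup_I_quotient_mulEquiv (n := n)
  have h : (I n).relIndex (commutator (F n) ⊔ I n) * (commutator (F n) ⊔ I n).index =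
      (I n).index := relIndex_mul_index le_sup_right
  have h1 : (I n).relIndex (commutator (F n) ⊔ I n) = 2 ^ ((n ^ 3 + n ^ 2) / 2) := by
    rw [← card_C₂Pow, ← Nat.card_congr e'.toEquiv]; rfl
  have h2 : (commutator (F n) ⊔ I n).index = 2 ^ (2 * n) := by
    rw [← card_C₂Pow, ← Nat.card_congr e.toEquiv]; rfl
  rw [h1, h2, ← pow_add] at h
  rw [← Subgroup.index_eq_card, ← h]
  congr 1
  omega

theorem K_lt_I (hn : 2 ≤ n) : K n < I n := by
  refine lt_of_le_of_ne K_le_I fun h => ?_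
  have hlt : (⟨0, by omega⟩ : Fin n) < ⟨1, by omega⟩ := by simp
  have h1 : comm (a ⟨1, by omega⟩) (a ⟨0, by omega⟩) ∈ K n := h ▸ comm_a_a_mem_I _ _
  have h2 := DFunctional_eq_zero (.inl (.inl ⟨(_, _), hlt⟩)) h1
  have h3 := DFunctional_DElement (n := n) (.inl (.inl ⟨(_, _), hlt⟩))
    (.inl (.inl ⟨(_, _), hlt⟩))
  rw [if_pos rfl] at h3
  exact one_ne_zero (h3.symm.trans h2)

end Abelianization

end MixedDihedral

theorem mainTheorem4 (n : ℕ) (hn : 2 ≤ n) :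
    ∃ (_ : (MixedDihedral.K n).Normal) (_ : (MixedDihedral.I n).Normal),
      -- the position of `I` in `F`, and the abelianization of `F / I`
      MixedDihedral.K n < MixedDihedral.I n ∧
      MixedDihedral.I n ≤ commutator (MixedDihedral.F n) ⊔ MixedDihedral.I n ∧
      commutator (MixedDihedral.F n) ⊔ MixedDihedral.I n =
        commutator (MixedDihedral.F n) ⊔ MixedDihedral.K n ∧
      Nonempty (Abelianization (MixedDihedral.F n ⧸ MixedDihedral.I n) ≃*
        MixedDihedral.F n ⧸ (commutator (MixedDihedral.F n) ⊔ MixedDihedral.I n)) ∧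
      Nonempty ((MixedDihedral.F n ⧸ (commutator (MixedDihedral.F n) ⊔ MixedDihedral.I n)) ≃*
        MixedDihedral.C₂Pow (2 * n)) ∧
      -- the smaller generating set of `I`
      MixedDihedral.I n =
        Subgroup.closure ((MixedDihedral.K n : Set (MixedDihedral.F n)) ∪ MixedDihedral.D n) ∧
      -- the structure of `I / K`, of `F'I / I` and of `F / I`
      Nonempty ((MixedDihedral.I n ⧸ (MixedDihedral.K n).subgroupOf (MixedDihedral.I n)) ≃*
        MixedDihedral.C₂Pow ((13 * n ^ 3 - 15 * n ^ 2 + 2 * n) / 6)) ∧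
      Nonempty ((↥(commutator (MixedDihedral.F n) ⊔ MixedDihedral.I n) ⧸
          (MixedDihedral.I n).subgroupOf
            (commutator (MixedDihedral.F n) ⊔ MixedDihedral.I n)) ≃*
        MixedDihedral.C₂Pow ((n ^ 3 + n ^ 2) / 2)) ∧
      MixedDihedral.HasNilpotencyClass (MixedDihedral.F n ⧸ MixedDihedral.I n) 3 ∧
      Nat.card (MixedDihedral.F n ⧸ MixedDihedral.I n) = 2 ^ ((n ^ 3 + n ^ 2 + 4 * n) / 2) ∧
      -- the mutually inverse epimorphisms between `𝓗(n)` and `F / I`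
      (∃ (φ : MixedDihedral.H n →* MixedDihedral.F n ⧸ MixedDihedral.I n)
          (ψ : MixedDihedral.F n ⧸ MixedDihedral.I n →* MixedDihedral.H n),
        (∀ i : Fin n, φ (MixedDihedral.x i) = QuotientGroup.mk (MixedDihedral.a i)) ∧
        (∀ i : Fin n, φ (MixedDihedral.y i) = QuotientGroup.mk (MixedDihedral.b i)) ∧
        (∀ i : Fin n, ψ (QuotientGroup.mk (MixedDihedral.a i)) = MixedDihedral.x i) ∧
        (∀ i : Fin n, ψ (QuotientGroup.mk (MixedDihedral.b i)) = MixedDihedral.y i) ∧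
        Function.Surjective φ ∧ Function.Surjective ψ ∧
        Function.LeftInverse ψ φ ∧ Function.RightInverse ψ φ) ∧
      Nonempty (MixedDihedral.H n ≃* MixedDihedral.F n ⧸ MixedDihedral.I n) ∧
      -- the order and the nilpotency class of `𝓗(n)`
      Nat.card (MixedDihedral.H n) = 2 ^ ((n ^ 3 + n ^ 2 + 4 * n) / 2) ∧
      MixedDihedral.HasNilpotencyClass (MixedDihedral.H n) 3 := by

  open MixedDihedral in
  refine ⟨K_normal, I_normal, K_lt_I hn, le_sup_right, commutator_sup_I_eq,
    nonempty_abelianization_quotient_mulEquiv _, nonempty_quotient_commutator_sup_I_mulEquiv,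
    I_eq_closure_D, nonempty_I_quotient_mulEquiv hn, nonempty_commutator_sup_I_quotient_mulEquiv,
    hasNilpotencyClass_succ lowerCentralSeries_quotient_I (lowerCentralSeries_quotient_I_ne hn),
    card_quotient_I, ⟨(mulEquivH n).toMonoidHom, (mulEquivH n).symm.toMonoidHom,
      fun i => mulEquivH_mk _, fun i => mulEquivH_mk _,
      fun i => (mulEquivH n).symm_apply_eq.2 (mulEquivH_mk _).symm,
      fun i => (mulEquivH n).symm_apply_eq.2 (mulEquivH_mk _).symm,
      (mulEquivH n).surjective, (mulEquivH n).symm.surjective,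
      (mulEquivH n).left_inv, (mulEquivH n).right_inv⟩,
    ⟨mulEquivH n⟩, (Nat.card_congr (mulEquivH n).toEquiv).trans card_quotient_I,
    hasNilpotencyClass_succ lowerCentralSeries_H fun h => lowerCentralSeries_quotient_I_ne hn
      (lowerCentralSeries_eq_bot_of_surjective (f := (mulEquivH n).toMonoidHom)
        (mulEquivH n).surjective h)⟩
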